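/- Fix a time step $k$ and a dimension $n_x\ge 1$. A trajectory up to time $k$ is $X=(t,x^{1:i})$ with $t\ge 1$, $1\le i\le k-t+1$ and $x^{1:i}=(x^1,\dots,x^i)\in(\mathbb{R}^{n_x})^i$; it is alive at time $k$ if $t+i-1=k$. Write $\int g(X)\,dX=\sum_{(t,i)}\int g(t,x^{1:i})\,dx^{1:i}$. For a function $g$ of finite sets, the set integral is $\int g(\mathbf X)\,\delta\mathbf X=\sum_{n\ge 0}\frac1{n!}\int g(\{X_1,\dots,X_n\})\,dX_1\cdots dX_n$; the Poisson point process (PPP) with intensity $\lambda\ge 0$, $\int\lambda<\infty$, has density $\mathbf X\mapsto e^{-\int\lambda}\prod_{X\in\mathbf X}\lambda(X)$; and the PHD of a random finite set with density $g$ is $X\mapsto\int g(\{X\}\cup\mathbf X)\,\delta\mathbf X$. Suppose that the prior set of trajectories is a PPP with measurable intensity (trajectory PHD) $\lambda_{k|k-1}\ge 0$ of finite total mass which vanishes on trajectories that are not alive at time $k$. Let the measurement space be a $\sigma$-finite measure space without atoms. Each target with current state $x\in\mathbb{R}^{n_x}$ independently generates a finite set of measurements with density $f(\cdot\,|\,x)$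 (nonnegative, with set integral $1$), and independent clutter is a PPP with intensity $\lambda^C$ of finite total mass. Thus, given a finite set $\mathbf X$ of trajectories whose alive members have the current states $\{x_1,\dots,x_n\}$, the observed set $\mathbf z$ has density $$\ell(\mathbf z\,|\,\mathbf X)=\sum_{\mathbf z^C\uplus\mathbf z_1\uplus\dots\uplus\mathbf z_n=\mathbf z}e^{-\int\lambda^C}\prod_{z\in\mathbf z^C}\lambda^C(z)\prod_{j=1}^n f(\mathbf z_j\,|\,x_j).$$ Let $\mathbf z_k$ be a finite set of measurements for which the normalizing constant $\int\ell(\mathbf z_k|\mathbf X)\,\pi_{k|k-1}(\mathbf X)\,\delta\mathbf X$ of Bayes' rule is positive and finite, where $\pi_{k|k-1}$ is the prior density, and let $\pi_k(\mathbf X)=\ell(\mathbf z_k|\mathbf X)\pi_{k|k-1}(\mathbf X)/\int\ell(\mathbf z_k|\mathbf Y)\pi_{k|k-1}(\mathbf Y)\,\delta\mathbf Y$ be the posterior density. For $x\in\mathbb{R}^{n_x}$ let $\lambda_{k|k-1}(x)=\sum_{t+i-1=k}\int\lambda_{k|k-1}(t,(x^{1:i-1},x))\,dx^{1:i-1}$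 be the PHD of the current targets, and for nonempty $\mathbf w\subseteq\mathbf z_k$ put $\tau_{\mathbf w}=\int f(\mathbf w|x)\lambda_{k|k-1}(x)\,dx$, and $\kappa_{\mathbf w}=\lambda^C(z)$ if $\mathbf w=\{z\}$, $\kappa_{\mathbf w}=0$ if $|\mathbf w|>1$. With $P,Q$ ranging over the partitions of $\mathbf z_k$ into nonempty cells, put $$w_P=\frac{\prod_{\mathbf w\in P}(\kappa_{\mathbf w}+\tau_{\mathbf w})}{\sum_{Q}\prod_{\mathbf w\in Q}(\kappa_{\mathbf w}+\tau_{\mathbf w})},\qquad L_{\mathbf z_k}(x)=f(\emptyset|x)+\sum_{P}w_P\sum_{\mathbf w\in P}\frac{f(\mathbf w|x)}{\kappa_{\mathbf w}+\tau_{\mathbf w}},$$ where partitions with $w_P=0$ contribute zero. Define $$\lambda_{k|k}(t,x^{1:i})=\begin{cases}L_{\mathbf z_k}(x^i)\,\lambda_{k|k-1}(t,x^{1:i}) & \text{if } t+i-1=k,\\ 0 & \text{otherwise.}\end{cases}$$ Then, among all measurable intensities $\nu\ge 0$ of finite total mass on the space of trajectories, the Kullback-Leibler divergence $\int\pi_k\log(\pi_k/\pi_\nu)\,\delta\mathbf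 X$ from the posterior density $\pi_k$ to the PPP density $\pi_\nu$ of intensity $\nu$ is minimized by $\nu=\lambda_{k|k}$, and by no other $\nu$ up to almost everywhere equality. Moreover, the PHD of the posterior equals $\lambda_{k|k}$ almost everywhere. -/

import Mathlib

open MeasureTheory
open scoped ENNReal

/-! ## Random finite sets -/

/-- The space of all finite subsets of `T`. It is a copy of `Finset T` that carries a σ-algebra
induced by that of `T` (the one that `Finset T` itself carries does not depend on it). -/
def FiniteSubsets (T : Type*) : Type _ := Finset T

open Classical in
/-- The finite set of the entries of a tuple. -/
noncomputable def tupleSet {T : Type*} (n : ℕ) (x : Fin n → T) : FiniteSubsets T :=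
  Finset.univ.image x

/-- A family of finite subsets is measurable when, for every `n`, the tuples `(x₁, …, xₙ)` with
`{x₁, …, xₙ}` in the family form a measurable set. -/
noncomputable instance FiniteSubsets.instMeasurableSpace {T : Type*} [MeasurableSpace T] :
    MeasurableSpace (FiniteSubsets T) :=
  ⨅ n : ℕ, MeasurableSpace.map (tupleSet (T := T) n) inferInstance

theorem measurable_tupleSet {T : Type*} [MeasurableSpace T] (n : ℕ) :
    Measurable (tupleSet (T := T) n) := by
  intro s hs
  exact (MeasurableSpace.measurableSet_iInf.1 hs) n

/-- The set integral `∫ g(X) δX = ∑ₙ (1/n!) ∫ g({x₁, …, xₙ}) dx₁ ⋯ dxₙ`. -/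
noncomputable def setIntegral {T : Type*} [MeasurableSpace T] (μ : Measure T)
    (g : Finset T → ℝ≥0∞) : ℝ≥0∞ :=
  ∑' n : ℕ, ((n.factorial : ℕ) : ℝ≥0∞)⁻¹ *
    ∫⁻ x : Fin n → T, g (tupleSet n x) ∂(Measure.pi fun _ => μ)

/-- The reference measure `δX` on finite sets, with respect to which densities of random finite
sets are taken. -/
noncomputable def finsetMeasure {T : Type*} [MeasurableSpace T] (μ : Measure T) :
    Measure (FiniteSubsets T) :=
  Measure.sum fun n : ℕ => ((n.factorial : ℕ) : ℝ≥0∞)⁻¹ •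
    Measure.map (tupleSet n) (Measure.pi fun _ : Fin n => μ)

/-- Integration against `finsetMeasure` is the set integral. -/
theorem lintegral_finsetMeasure {T : Type*} [MeasurableSpace T] (μ : Measure T)
    {g : FiniteSubsets T → ℝ≥0∞} (hg : Measurable g) :
    ∫⁻ X, g X ∂(finsetMeasure μ) = setIntegral μ g := by
  unfold finsetMeasure setIntegral
  rw [lintegral_sum_measure]
  congr 1
  funext n
  rw [lintegral_smul_measure, lintegral_map hg (measurable_tupleSet n), smul_eq_mul]

/-- `g` is the density of a random finite set: measurable with set integral one. -/
def IsSetDensity {T : Type*} [MeasurableSpace T] (μ : Measure T) (g : Finset T → ℝ≥0∞) : Prop :=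
  Measurable (fun X : FiniteSubsets T => g X) ∧ setIntegral μ g = 1

/-- The density `e^{-∫λ} ∏_{x ∈ X} λ(x)` of a Poisson point process with intensity `lam`. -/
noncomputable def poissonDensity {T : Type*} [MeasurableSpace T] (μ : Measure T)
    (lam : T → ℝ≥0∞) (X : Finset T) : ℝ≥0∞ :=
  ENNReal.ofReal (Real.exp (-(∫⁻ x, lam x ∂μ).toReal)) * ∏ x ∈ X, lam x

/-- The probability hypothesis density `D(x) = ∫ g({x} ∪ X) δX` of a random finite set with
density `g`. -/
noncomputable def phd {T : Type*} [MeasurableSpace T] (μ : Measure T)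
    (g : Finset T → ℝ≥0∞) (x : T) : ℝ≥0∞ :=
  open Classical in setIntegral μ fun X => g (insert x X)

/-- The Kullback-Leibler divergence `∫ g(X) log (g(X) / h(X)) δX` of the random finite sets with
densities `g` and `h`. -/
noncomputable def setKLD {T : Type*} [MeasurableSpace T] (μ : Measure T)
    (g h : Finset T → ℝ≥0∞) : ℝ≥0∞ :=
  InformationTheory.klDiv ((finsetMeasure μ).withDensity fun X : FiniteSubsets T => g X)
    ((finsetMeasure μ).withDensity fun X : FiniteSubsets T => h X)

/-- `nu` is the intensity of a best Poisson approximation of the density `g`: a measurable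
intensity with finite total mass whose Poisson density has the least divergence from `g` among
all such intensities. -/
def IsBestPoisson {T : Type*} [MeasurableSpace T] (μ : Measure T) (g : Finset T → ℝ≥0∞)
    (nu : T → ℝ≥0∞) : Prop :=
  Measurable nu ∧ ∫⁻ x, nu x ∂μ ≠ ∞ ∧
    ∀ nu' : T → ℝ≥0∞, Measurable nu' → ∫⁻ x, nu' x ∂μ ≠ ∞ →
      setKLD μ g (poissonDensity μ nu) ≤ setKLD μ g (poissonDensity μ nu')

/-! ## Trajectories -/

/-- Single-target states. -/
abbrev TargetState (nx : ℕ) : Type := Fin nx → ℝ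

/-- Pairs `(t, i)` of a start time and a length with `1 ≤ t ≤ k` and `1 ≤ i ≤ k - t + 1`. -/
abbrev TrajIndex (k : ℕ) : Type :=
  {p : ℕ × ℕ // 1 ≤ p.1 ∧ 1 ≤ p.2 ∧ p.1 + p.2 ≤ k + 1}

/-- Trajectories `(t, x^{1:i})` up to time `k`; the disjoint union over `(t, i)` of
`ℝ^{i × nx}`. -/
abbrev Trajectory (k nx : ℕ) : Type :=
  Σ p : TrajIndex k, (Fin p.1.2 → TargetState nx)

/-- The integral over trajectories: the sum over `(t, i)` of the Lebesgue integrals. -/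
noncomputable def trajMeasure (k nx : ℕ) : Measure (Trajectory k nx) :=
  Measure.sum fun p : TrajIndex k =>
    Measure.map (Sigma.mk p) (volume : Measure (Fin p.1.2 → TargetState nx))

/-- A trajectory is alive at time `k` when `t + i - 1 = k`. -/
def Trajectory.IsAlive {k nx : ℕ} (X : Trajectory k nx) : Prop :=
  X.1.1.1 + X.1.1.2 = k + 1

/-- The last state `x^i` of a trajectory. -/
def Trajectory.lastState {k nx : ℕ} (X : Trajectory k nx) : TargetState nx :=
  X.2 ⟨X.1.1.2 - 1, by have h := X.1.2.2.1; omega⟩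

open Classical in
/-- The multi-target state at time `k` of a set of trajectories. -/
noncomputable def currentTargets {k nx : ℕ} (X : Finset (Trajectory k nx)) :
    Finset (TargetState nx) :=
  (X.filter fun Y => Y.IsAlive).image fun Y => Y.lastState

/-- The PHD of the current set of targets, by marginalization of a trajectory PHD:
`λ(x) = ∑_{(t, i), t + i - 1 = k} ∫ λ(t, (x^{1:i-1}, x)) dx^{1:i-1}`, where `i = j + 1` and
`t = k - j`. -/
noncomputable def targetPHD {k nx : ℕ} (lam : Trajectory k nx → ℝ≥0∞) (x : TargetState nx) :
    ℝ≥0∞ :=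
  ∑ j : Fin k, ∫⁻ y : Fin (j : ℕ) → TargetState nx,
    lam ⟨⟨(k - (j : ℕ), (j : ℕ) + 1), by have h := j.2; simp only; omega⟩,
      Fin.snoc (α := fun _ => TargetState nx) y x⟩

/-! ## Measurements and the update -/

/-- The density `ℓ(z | x)` of the measurement set, the union of Poisson clutter of intensity
`lamC` and of the independent measurement sets of the targets in `x`, the target `ξ` having the
density `f ξ`. By the convolution formula it is the sum over all ways to write `z` as a disjoint
union of a clutter set and a (possibly empty) set for each target; such a decomposition is given
by the map that sends each measurement to its origin, `none` being clutter. -/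
noncomputable def targetLikelihood {nx : ℕ} {Z : Type*} [MeasureSpace Z]
    (f : TargetState nx → Finset Z → ℝ≥0∞) (lamC : Z → ℝ≥0∞) (z : Finset Z)
    (x : Finset (TargetState nx)) : ℝ≥0∞ :=
  open Classical in
  ∑ origin : (z → Option x),
    poissonDensity volume lamC
        ((Finset.univ.filter fun ζ : z => origin ζ = none).image Subtype.val) *
      ∏ ξ : x, f ξ ((Finset.univ.filter fun ζ : z => origin ζ = some ξ).image Subtype.val)

/-- The density of the measurement set given a set of trajectories, which depends only on the
current multi-target state. -/
noncomputable def trajLikelihood {k nx : ℕ} {Z : Type*} [MeasureSpace Z]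
    (f : TargetState nx → Finset Z → ℝ≥0∞) (lamC : Z → ℝ≥0∞) (z : Finset Z)
    (X : Finset (Trajectory k nx)) : ℝ≥0∞ :=
  targetLikelihood f lamC z (currentTargets X)

/-- The normalizing constant of Bayes' rule for a prior multi-trajectory density. -/
noncomputable def evidence {k nx : ℕ} {Z : Type*} [MeasureSpace Z]
    (f : TargetState nx → Finset Z → ℝ≥0∞) (lamC : Z → ℝ≥0∞) (z : Finset Z)
    (prior : Finset (Trajectory k nx) → ℝ≥0∞) : ℝ≥0∞ :=
  setIntegral (trajMeasure k nx) fun X => trajLikelihood f lamC z X * prior X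

/-- The posterior multi-trajectory density given by Bayes' rule. -/
noncomputable def posterior {k nx : ℕ} {Z : Type*} [MeasureSpace Z]
    (f : TargetState nx → Finset Z → ℝ≥0∞) (lamC : Z → ℝ≥0∞) (z : Finset Z)
    (prior : Finset (Trajectory k nx) → ℝ≥0∞) (X : Finset (Trajectory k nx)) : ℝ≥0∞ :=
  trajLikelihood f lamC z X * prior X / evidence f lamC z prior

/-- `τ_w = ∫ f(w | x) λ(x) dx`. -/
noncomputable def tauCell {nx : ℕ} {Z : Type*} (f : TargetState nx → Finset Z → ℝ≥0∞)
    (lamT : TargetState nx → ℝ≥0∞) (w : Finset Z) : ℝ≥0∞ :=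
  ∫⁻ x, f x w * lamT x

/-- `κ_w = δ₁[|w|] ∏_{ζ ∈ w} λ^C(ζ)`. -/
noncomputable def kappaCell {Z : Type*} (lamC : Z → ℝ≥0∞) (w : Finset Z) : ℝ≥0∞ :=
  if w.card = 1 then ∏ ζ ∈ w, lamC ζ else 0

open Classical in
/-- The weight `w_P` of a partition of `z`. -/
noncomputable def partitionWeight {nx : ℕ} {Z : Type*} (f : TargetState nx → Finset Z → ℝ≥0∞)
    (lamC : Z → ℝ≥0∞) (lamT : TargetState nx → ℝ≥0∞) {z : Finset Z} (P : Finpartition z) :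
    ℝ≥0∞ :=
  (∏ w ∈ P.parts, (kappaCell lamC w + tauCell f lamT w)) /
    ∑ Q : Finpartition z, ∏ w ∈ Q.parts, (kappaCell lamC w + tauCell f lamT w)

open Classical in
/-- The pseudolikelihood
`L_z(x) = f(∅ | x) + ∑_P w_P ∑_{w ∈ P} f(w | x) / (κ_w + τ_w)`. -/
noncomputable def pseudoLikelihood {nx : ℕ} {Z : Type*} (f : TargetState nx → Finset Z → ℝ≥0∞)
    (lamC : Z → ℝ≥0∞) (lamT : TargetState nx → ℝ≥0∞) (z : Finset Z) (x : TargetState nx) :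
    ℝ≥0∞ :=
  f x ∅ + ∑ P : Finpartition z, partitionWeight f lamC lamT P *
    ∑ w ∈ P.parts, f x w / (kappaCell lamC w + tauCell f lamT w)

open Classical in
/-- The updated trajectory PHD: `L_z(x^i) λ(t, x^{1:i})` on alive trajectories, and zero on the
others. -/
noncomputable def updatedPHD {k nx : ℕ} {Z : Type*} (f : TargetState nx → Finset Z → ℝ≥0∞)
    (lamC : Z → ℝ≥0∞) (lam : Trajectory k nx → ℝ≥0∞) (z : Finset Z) (X : Trajectory k nx) :
    ℝ≥0∞ :=
  if X.IsAlive then pseudoLikelihood f lamC (targetPHD lam) z X.lastState * lam X else 0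

/-!
The posterior of a Poisson prior is not Poisson, but its best Poisson approximation is the Poisson
process with the same PHD, and that PHD can be computed.

*Best approximation.* Let `g` be the density of a random finite set with PHD `D`, and let `ν` be
another intensity. The logarithm of the ratio of the Poisson densities of intensities `D` and `ν`
is `∫ν - ∫D` plus the sum of `log (D / ν)` over the points. By Campbell's formula
(`setIntegral_mul_sum`) the expectation of such a sum under `g` depends on `g` only through `D`,
so that passing from `D` to `ν` increases the divergence by that between the two Poisson processes
(`setKLD_poissonDensity_eq`), which vanishes only if `ν = D` almost everywhere. This determines the
minimizer provided that the divergence from `g` to the `D`-Poisson process is finite.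

*The PHD of the posterior.* Almost surely the last states of the trajectories are distinct, and
the likelihood of a tuple of trajectories is a sum over the assignments of the measurements to
clutter and to the targets (`assignSum`). Integrating out the trajectories turns the evidence into
an exponential series `assignSeries` in the cell weights `τ`; conditioning on the origin of one
measurement gives the recursion that the sum over partitions also satisfies, whence the
exponential formula `assignSeries_eq_partitionSum`. Singling out the measurements `w` generated by
one trajectory gives the PHD as `λ ∑_w f(w | x) S(z \ w) / S(z)` with `S` the series
(`phd_posterior`), and grouping the partitions by the cell `w` identifies this with the
pseudolikelihood formula (`updatedPHD_ae_eq`).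

*Finite divergence.* Each term `f(w | x) S(z \ w) λ / S(z)` of the PHD is at most the PHD itself, so
that every assignment contributes to the posterior at most the product of the PHD over the
trajectories, up to a factor geometric in their number (`assignSum_le_geometric`). Assignments
for which some `S(z \ w)` vanishes contribute nothing. The logarithm of a geometric factor is linear
in the number of points, which has finite mean (`setKLD_poissonDensity_ne_top`).
-/

/-! ### Finite sets listed by tuples -/

open Classical in
theorem tupleSet_insertNth {T : Type*} {n : ℕ} (i : Fin (n + 1)) (a : T) (y : Fin n → T) :
    tupleSet (n + 1) (i.insertNth a y) = (insert a (tupleSet n y : Finset T) : Finset T) := by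
  refine Finset.ext (α := T) fun t => ?_
  simp only [tupleSet, Finset.mem_image, Finset.mem_univ, true_and, Finset.mem_insert]
  constructor
  · rintro ⟨j, rfl⟩
    refine Fin.succAboveCases i ?_ (fun j => ?_) j
    · simp
    · right; exact ⟨j, by simp⟩
  · rintro (rfl | ⟨j, rfl⟩)
    · exact ⟨i, by simp⟩
    · exact ⟨i.succAbove j, by simp⟩

theorem prod_tupleSet {T M : Type*} [CommMonoid M] {n : ℕ} {x : Fin n → T}
    (hx : Function.Injective x) (h : T → M) :
    Finset.prod (tupleSet n x : Finset T) h = ∏ i, h (x i) := by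
  classical
  unfold tupleSet
  rw [Finset.prod_image fun i _ j _ hij => hx hij]

theorem sum_tupleSet {T M : Type*} [AddCommMonoid M] {n : ℕ} {x : Fin n → T}
    (hx : Function.Injective x) (h : T → M) :
    Finset.sum (tupleSet n x : Finset T) h = ∑ i, h (x i) := by
  classical
  unfold tupleSet
  rw [Finset.sum_image fun i _ j _ hij => hx hij]

/-! ### Measurability and null sets for finite sets of points -/

section FiniteSubsets

variable {T E β : Type*} [MeasurableSpace T] [MeasurableSpace E] [MeasurableSpace β]

/-- The σ-algebra on finite sets is final for the maps that forget the order of a tuple. -/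
theorem measurable_of_comp_tupleSet {g : FiniteSubsets T → β}
    (h : ∀ n, Measurable fun x : Fin n → T => g (tupleSet n x)) : Measurable g := by
  intro s hs
  exact MeasurableSpace.measurableSet_iInf.2 fun n => h n hs

theorem ae_finsetMeasure {μ : Measure T} {p : FiniteSubsets T → Prop}
    (hp : MeasurableSet {X | p X})
    (h : ∀ n, ∀ᵐ x ∂(Measure.pi fun _ : Fin n => μ), p (tupleSet n x)) :
    ∀ᵐ X ∂(finsetMeasure μ), p X := by
  unfold finsetMeasure
  rw [Measure.ae_sum_iff' hp]
  intro n
  refine Measure.ae_smul_measure ?_ _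
  rw [ae_map_iff (measurable_tupleSet n).aemeasurable hp]
  exact h n

open Classical in
/-- A function of the set `φ '' (X ∩ {p})` is measurable in the finite set `X` as soon as it is a
measurable function of the points of that set when these are listed without repetition. -/
theorem measurable_image_filter [MeasurableEq E] {p : T → Prop} (hp : MeasurableSet {t | p t})
    {φ : T → E} (hφ : Measurable φ) (h : Finset E → β)
    (hH : ∀ (ι : Type) [Fintype ι], ∃ H : (ι → E) → β, Measurable H ∧
      ∀ y : ι → E, Function.Injective y → H y = h (Finset.univ.image y)) :
    Measurable fun X : FiniteSubsets T => h ((Finset.filter p X).image φ) := by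
  refine measurable_of_comp_tupleSet fun n => ?_
  -- `R x` selects, for each point of `φ '' (X ∩ {p})`, the first index that represents it
  let R : (Fin n → T) → Finset (Fin n) := fun x =>
    Finset.univ.filter fun i => p (x i) ∧ ∀ j < i, p (x j) → φ (x j) ≠ φ (x i)
  choose H hHm hHeq using fun S : Finset (Fin n) => hH S
  have key : ∀ x : Fin n → T, h ((Finset.filter p (tupleSet n x : Finset T)).image φ)
      = H (R x) fun i => φ (x i) := by
    intro x
    rw [hHeq]
    · congr 1
      ext e
      simp only [tupleSet, Finset.mem_image, Finset.mem_filter, Finset.mem_univ, true_and]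
      constructor
      · rintro ⟨t, ⟨⟨i, rfl⟩, hi⟩, rfl⟩
        have hne : (Finset.univ.filter fun j => p (x j) ∧ φ (x j) = φ (x i)).Nonempty :=
          ⟨i, by simp [hi]⟩
        have hmin := Finset.min'_mem _ hne
        have hle := fun j hj => Finset.min'_le
          (Finset.univ.filter fun j => p (x j) ∧ φ (x j) = φ (x i)) j hj
        set m := Finset.min' _ hne
        simp only [Finset.mem_filter, Finset.mem_univ, true_and] at hmin hle
        refine ⟨⟨m, ?_⟩, hmin.2⟩
        simp only [R, Finset.mem_filter, Finset.mem_univ, true_and]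
        refine ⟨hmin.1, fun j hj hpj he => ?_⟩
        exact absurd (hle j ⟨hpj, he.trans hmin.2⟩) (not_le.2 hj)
      · rintro ⟨⟨i, hi⟩, rfl⟩
        simp only [R, Finset.mem_filter, Finset.mem_univ, true_and] at hi
        exact ⟨x i, ⟨⟨i, rfl⟩, hi.1⟩, rfl⟩
    · rintro ⟨i, hi⟩ ⟨j, hj⟩ hij
      simp only [R, Finset.mem_filter, Finset.mem_univ, true_and] at hi hj hij
      rcases lt_trichotomy i j with hlt | heq | hlt
      · exact absurd hij (hj.2 i hlt hi.1)
      · exact Subtype.ext heq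
      · exact absurd hij.symm (hi.2 j hlt hj.1)
  simp_rw [key]
  have hR : ∀ S, MeasurableSet {x | R x = S} := by
    intro S
    have : {x | R x = S} = {x | ∀ i, (p (x i) ∧ ∀ j, j < i → p (x j) → φ (x j) ≠ φ (x i)) ↔
        i ∈ S} := by
      ext x
      simp [R, Finset.ext_iff]
    rw [this]
    have hpi : ∀ i, Measurable fun x : Fin n → T => p (x i) := fun i =>
      measurableSet_setOfPred.1 ((measurable_pi_apply i) hp)
    refine measurableSet_setOfPred.2 (Measurable.forall fun i => Measurable.iff
      ((hpi i).and (Measurable.forall fun j => Measurable.imp measurable_const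
        ((hpi j).imp (Measurable.not (Measurable.eq ?_ ?_))))) measurable_const)
    · exact hφ.comp (measurable_pi_apply j)
    · exact hφ.comp (measurable_pi_apply i)
  intro B hB
  have : (fun x => H (R x) fun i => φ (x i)) ⁻¹' B =
      ⋃ S, {x | R x = S} ∩ (fun x : Fin n → T => H S fun i => φ (x i)) ⁻¹' B := by
    ext x
    simp
  rw [this]
  refine MeasurableSet.iUnion fun S => (hR S).inter ?_
  refine ((hHm S).comp ?_) hB
  exact measurable_pi_lambda _ fun i => hφ.comp (measurable_pi_apply _)

open Classical in
theorem measurable_of_forall_injective [MeasurableEq T] (h : Finset T → β)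
    (hH : ∀ (ι : Type) [Fintype ι], ∃ H : (ι → T) → β, Measurable H ∧
      ∀ y : ι → T, Function.Injective y → H y = h (Finset.univ.image y)) :
    Measurable fun X : FiniteSubsets T => h X := by
  have e : ∀ X : Finset T, h X =
      h ((@Finset.filter T (fun _ => True) (fun _ => Classical.propDecidable _) X).image id) := by
    intro X
    congr 1
    ext t
    simp
  have hm := measurable_image_filter (p := fun _ : T => True) MeasurableSet.univ measurable_id h hH
  exact (funext e : (fun X : FiniteSubsets T => h X) = _) ▸ hm

theorem measurable_prod_finiteSubsets [MeasurableEq T] {h : T → ℝ≥0∞} (hh : Measurable h) :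
    Measurable fun X : FiniteSubsets T => Finset.prod X h := by
  classical
  refine measurable_of_forall_injective (fun X => ∏ x ∈ X, h x)
    (fun ι _ => ⟨fun y => ∏ i, h (y i), ?_, fun y hy => ?_⟩)
  · exact Finset.measurable_prod _ fun i _ => hh.comp (measurable_pi_apply i)
  · rw [Finset.prod_image fun i _ j _ hij => hy hij]

theorem measurable_sum_finiteSubsets [MeasurableEq T] {γ : Type*} [AddCommMonoid γ]
    [MeasurableSpace γ] [MeasurableAdd₂ γ] {h : T → γ} (hh : Measurable h) :
    Measurable fun X : FiniteSubsets T => Finset.sum X h := by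
  classical
  refine measurable_of_forall_injective (fun X => ∑ x ∈ X, h x)
    (fun ι _ => ⟨fun y => ∑ i, h (y i), ?_, fun y hy => ?_⟩)
  · exact Finset.measurable_sum _ fun i _ => hh.comp (measurable_pi_apply i)
  · rw [Finset.sum_image fun i _ j _ hij => hy hij]

theorem measurable_poissonDensity [MeasurableEq T] (μ : Measure T) {lam : T → ℝ≥0∞}
    (hlam : Measurable lam) : Measurable fun X : FiniteSubsets T => poissonDensity μ lam X :=
  (measurable_prod_finiteSubsets hlam).const_mul _

end FiniteSubsets

/-! ### Integration over tuples of points -/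

section Tuples

variable {T E : Type*} [MeasurableSpace T] [MeasurableSpace E]

/-- Tonelli's theorem, with the coordinate `i` integrated last. -/
theorem lintegral_pi_insertNth (μ : Measure T) [SigmaFinite μ] {n : ℕ} (i : Fin (n + 1))
    {F : (Fin (n + 1) → T) → ℝ≥0∞} (hF : Measurable F) :
    ∫⁻ x, F x ∂(Measure.pi fun _ => μ) =
      ∫⁻ a, ∫⁻ y, F (i.insertNth a y) ∂(Measure.pi fun _ : Fin n => μ) ∂μ := by
  have hmp := (measurePreserving_piFinSuccAbove (fun _ : Fin (n + 1) => μ) i).symm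
  rw [← hmp.lintegral_comp hF, lintegral_prod]
  · rfl
  · exact (hF.comp (MeasurableEquiv.measurable _)).aemeasurable

theorem ae_pi_insertNth (μ : Measure T) [SigmaFinite μ] {n : ℕ} (i : Fin (n + 1))
    {p : (Fin (n + 1) → T) → Prop} (hp : MeasurableSet {x | p x})
    (h : ∀ᵐ y ∂(Measure.pi fun _ : Fin n => μ), ∀ᵐ a ∂μ, p (i.insertNth a y)) :
    ∀ᵐ x ∂(Measure.pi fun _ : Fin (n + 1) => μ), p x := by
  have hmp := (measurePreserving_piFinSuccAbove (fun _ : Fin (n + 1) => μ) i).symm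
  rw [← hmp.map_eq, ae_map_iff hmp.measurable.aemeasurable hp]
  have hp' : MeasurableSet {q : T × (Fin n → T) | p (i.insertNth q.1 q.2)} :=
    hmp.measurable hp
  have : ∀ᵐ q ∂((Measure.pi fun _ : Fin n => μ).prod μ), p (i.insertNth q.2 q.1) := by
    rw [Measure.ae_prod_iff_ae_ae]
    · exact h
    · exact measurable_swap hp'
  rw [← Measure.prod_swap, ae_map_iff measurable_swap.aemeasurable]
  · exact this
  · exact hp'

theorem lintegral_pi_prod (μ : Measure T) [SigmaFinite μ] {n : ℕ} {F : Fin n → T → ℝ≥0∞}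
    (hF : ∀ i, Measurable (F i)) :
    ∫⁻ x, ∏ i, F i (x i) ∂(Measure.pi fun _ : Fin n => μ) = ∏ i, ∫⁻ a, F i a ∂μ := by
  induction n with
  | zero => simp
  | succ n ih =>
    rw [lintegral_pi_insertNth μ 0]
    · simp only [Fin.prod_univ_succ, Fin.insertNth_zero, Fin.cons_zero, Fin.cons_succ]
      have : ∀ a, ∫⁻ y, F 0 a * ∏ i : Fin n, F i.succ (y i) ∂(Measure.pi fun _ : Fin n => μ) =
          F 0 a * ∏ i : Fin n, ∫⁻ a, F i.succ a ∂μ := by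
        intro a
        rw [lintegral_const_mul, ih fun i => hF i.succ]
        exact Finset.measurable_prod _ fun i _ => (hF _).comp (measurable_pi_apply i)
      exact (lintegral_congr this).trans (lintegral_mul_const _ (hF 0))
    · exact Finset.measurable_prod _ fun i _ => (hF _).comp (measurable_pi_apply i)

/-- If the fibres of `φ` are null, the values of `φ` at the points of almost every tuple are
distinct. -/
theorem ae_injective_comp [MeasurableEq E] (μ : Measure T) [SigmaFinite μ] {φ : T → E}
    (hφ : Measurable φ) (hnull : ∀ e, μ (φ ⁻¹' {e}) = 0) (n : ℕ) :
    ∀ᵐ x ∂(Measure.pi fun _ : Fin n => μ), Function.Injective fun i => φ (x i) := by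
  induction n with
  | zero => exact Filter.Eventually.of_forall fun x => Function.injective_of_subsingleton _
  | succ n ih =>
    refine ae_pi_insertNth μ 0 ?_ ?_
    · refine measurableSet_setOfPred.2 (Measurable.forall fun i => Measurable.forall fun j =>
        Measurable.imp (Measurable.eq ?_ ?_) measurable_const)
      · exact hφ.comp (measurable_pi_apply i)
      · exact hφ.comp (measurable_pi_apply j)
    · filter_upwards [ih] with y hy
      have : ∀ᵐ a ∂μ, ∀ i : Fin n, φ a ≠ φ (y i) :=
        ae_all_iff.2 fun i => measure_eq_zero_iff_ae_notMem.1 (hnull (φ (y i)))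
      filter_upwards [this] with a ha
      have heq : (fun i => φ ((0 : Fin (n + 1)).insertNth (α := fun _ => T) a y i)) =
          Fin.cons (φ a) fun i => φ (y i) := by
        funext i
        refine Fin.cases ?_ (fun i => ?_) i <;> simp
      rw [heq, Fin.cons_injective_iff]
      refine ⟨?_, hy⟩
      rintro ⟨i, hi⟩
      exact ha i hi.symm

theorem ae_injective [MeasurableEq T] (μ : Measure T) [SigmaFinite μ] [NullSingletonClass μ]
    (n : ℕ) : ∀ᵐ x ∂(Measure.pi fun _ : Fin n => μ), Function.Injective x :=
  ae_injective_comp μ measurable_id (fun e => by simp) n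

end Tuples

/-! ### Campbell's formula and the Poisson density -/

section Campbell

variable {T : Type*} [MeasurableSpace T]

theorem inv_factorial_succ_mul (n : ℕ) :
    (((n + 1).factorial : ℕ) : ℝ≥0∞)⁻¹ * ((n + 1 : ℕ) : ℝ≥0∞) = ((n.factorial : ℕ) : ℝ≥0∞)⁻¹ := by
  rw [Nat.factorial_succ, Nat.cast_mul, ENNReal.mul_inv (by simp) (by simp),
    mul_right_comm, ENNReal.inv_mul_cancel (by simp) (by simp), one_mul]

/-- Campbell's formula: the PHD is the density of the expected number of points. -/
theorem setIntegral_mul_sum [MeasurableEq T] (μ : Measure T) [SigmaFinite μ]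
    [NullSingletonClass μ] {g : Finset T → ℝ≥0∞} (hg : Measurable fun X : FiniteSubsets T => g X)
    {h : T → ℝ≥0∞} (hh : Measurable h) :
    setIntegral μ (fun X => g X * ∑ x ∈ X, h x) = ∫⁻ x, h x * phd μ g x ∂μ := by
  classical
  have hgn : ∀ n, Measurable fun x : Fin n → T => g (tupleSet n x) := fun n =>
    hg.comp (measurable_tupleSet n)
  have hgi : ∀ n, Measurable fun q : T × (Fin n → T) =>
      g (insert q.1 (tupleSet n q.2 : Finset T)) := by
    intro n
    have := (hgn (n + 1)).comp
      (measurePreserving_piFinSuccAbove (fun _ : Fin (n + 1) => μ) 0).symm.measurable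
    convert this using 1
    funext q
    exact congrArg g (tupleSet_insertNth 0 q.1 q.2).symm
  have hterm : ∀ n, ∫⁻ x : Fin (n + 1) → T, g (tupleSet (n + 1) x) *
        Finset.sum (tupleSet (n + 1) x : Finset T) h ∂(Measure.pi fun _ => μ) =
      (n + 1 : ℕ) * ∫⁻ a, h a * ∫⁻ y, g (insert a (tupleSet n y : Finset T))
        ∂(Measure.pi fun _ : Fin n => μ) ∂μ := by
    intro n
    have h1 : ∫⁻ x : Fin (n + 1) → T, g (tupleSet (n + 1) x) *
        Finset.sum (tupleSet (n + 1) x : Finset T) h ∂(Measure.pi fun _ => μ) =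
        ∫⁻ x : Fin (n + 1) → T, ∑ i, g (tupleSet (n + 1) x) * h (x i)
          ∂(Measure.pi fun _ => μ) := by
      refine lintegral_congr_ae ?_
      filter_upwards [ae_injective μ (n + 1)] with x hx
      rw [sum_tupleSet hx, Finset.mul_sum]
    have hmeas : ∀ i, Measurable fun x : Fin (n + 1) → T => g (tupleSet (n + 1) x) * h (x i) :=
      fun i => (hgn _).mul (hh.comp (measurable_pi_apply i))
    rw [h1, lintegral_finsetSum _ fun i _ => hmeas i]
    have h2 : ∀ i : Fin (n + 1), ∫⁻ x : Fin (n + 1) → T, g (tupleSet (n + 1) x) * h (x i)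
        ∂(Measure.pi fun _ => μ) = ∫⁻ a, h a * ∫⁻ y, g (insert a (tupleSet n y : Finset T))
        ∂(Measure.pi fun _ : Fin n => μ) ∂μ := by
      intro i
      rw [lintegral_pi_insertNth μ i (hmeas i)]
      refine lintegral_congr fun a => ?_
      have hga : Measurable fun y : Fin n → T => g (insert a (tupleSet n y : Finset T)) :=
        (hgi n).comp measurable_prodMk_left
      refine Eq.trans ?_ (lintegral_const_mul (h a) hga)
      refine lintegral_congr fun y => ?_
      rw [Fin.insertNth_apply_same, mul_comm]
      congr 2
      exact tupleSet_insertNth i a y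
    rw [Finset.sum_congr rfl fun i _ => h2 i]
    simp
  unfold setIntegral
  rw [tsum_eq_zero_add' ENNReal.summable]
  have h0 : ∫⁻ x : Fin 0 → T, g (tupleSet 0 x) * Finset.sum (tupleSet 0 x : Finset T) h
      ∂(Measure.pi fun _ => μ) = 0 := by
    simp [tupleSet]
  simp_rw [hterm, h0, mul_zero, zero_add, ← mul_assoc]
  simp_rw [inv_factorial_succ_mul]
  have hmi : ∀ n, Measurable fun a => ∫⁻ y, g (insert a (tupleSet n y : Finset T))
      ∂(Measure.pi fun _ : Fin n => μ) := fun n => (hgi n).lintegral_prod_right'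
  unfold phd setIntegral
  simp_rw [← ENNReal.tsum_mul_left]
  rw [lintegral_tsum]
  · refine tsum_congr fun n => ?_
    have hm : Measurable fun a => h a * ∫⁻ y, g (insert a (tupleSet n y : Finset T))
      ∂(Measure.pi fun _ : Fin n => μ) := hh.mul (hmi n)
    refine (lintegral_const_mul _ hm).symm.trans (lintegral_congr fun a => ?_)
    exact mul_left_comm _ _ _
  · intro n
    exact (hh.mul ((hmi n).const_mul _)).aemeasurable

theorem tsum_inv_factorial_mul_pow {a : ℝ≥0∞} (ha : a ≠ ∞) :
    ∑' n : ℕ, ((n.factorial : ℕ) : ℝ≥0∞)⁻¹ * a ^ n = ENNReal.ofReal (Real.exp a.toReal) := by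
  have h1 : ∀ n : ℕ, ((n.factorial : ℕ) : ℝ≥0∞)⁻¹ * a ^ n =
      ENNReal.ofReal (a.toReal ^ n / (n.factorial : ℕ)) := by
    intro n
    rw [ENNReal.ofReal_div_of_pos (by positivity), ENNReal.ofReal_pow ENNReal.toReal_nonneg,
      ENNReal.ofReal_toReal ha, ENNReal.ofReal_natCast, ENNReal.div_eq_inv_mul]
  simp_rw [h1]
  rw [← ENNReal.ofReal_tsum_of_nonneg (fun n => by positivity)
    (Real.summable_pow_div_factorial _), Real.exp_eq_exp_ℝ, NormedSpace.exp_eq_tsum_div]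

/-- The normalization of the Poisson density is the exponential series. -/
theorem isSetDensity_poissonDensity [MeasurableEq T] (μ : Measure T) [SigmaFinite μ]
    [NullSingletonClass μ] {lam : T → ℝ≥0∞} (hlam : Measurable lam)
    (hfin : ∫⁻ x, lam x ∂μ ≠ ∞) : IsSetDensity μ (poissonDensity μ lam) := by
  refine ⟨measurable_poissonDensity μ hlam, ?_⟩
  have h1 : ∀ n : ℕ, ∫⁻ x : Fin n → T, poissonDensity μ lam (tupleSet n x)
      ∂(Measure.pi fun _ => μ) =
      ENNReal.ofReal (Real.exp (-(∫⁻ x, lam x ∂μ).toReal)) * (∫⁻ x, lam x ∂μ) ^ n := by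
    intro n
    have : ∫⁻ x : Fin n → T, poissonDensity μ lam (tupleSet n x) ∂(Measure.pi fun _ => μ) =
        ∫⁻ x : Fin n → T, ENNReal.ofReal (Real.exp (-(∫⁻ x, lam x ∂μ).toReal)) *
          ∏ i, lam (x i) ∂(Measure.pi fun _ => μ) := by
      refine lintegral_congr_ae ?_
      filter_upwards [ae_injective μ n] with x hx
      exact congrArg (ENNReal.ofReal (Real.exp (-(∫⁻ x, lam x ∂μ).toReal)) * ·)
        (prod_tupleSet hx lam)
    have hm : Measurable fun x : Fin n → T => ∏ i, lam (x i) :=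
      Finset.measurable_prod _ fun i _ => hlam.comp (measurable_pi_apply i)
    rw [this, lintegral_const_mul _ hm, lintegral_pi_prod μ fun _ => hlam]
    simp
  unfold setIntegral
  simp_rw [h1, mul_left_comm _ (ENNReal.ofReal _), ENNReal.tsum_mul_left]
  rw [tsum_inv_factorial_mul_pow hfin, ← ENNReal.ofReal_mul (Real.exp_pos _).le, ← Real.exp_add]
  simp

end Campbell

/-! ### Log-likelihood ratios of measures given by densities -/

section Densities

variable {α : Type*} [MeasurableSpace α] {M : Measure α} {g h : α → ℝ≥0∞}

theorem withDensity_withDensity_div (hg : Measurable g) (hh : Measurable h)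
    (hfin : ∫⁻ X, h X ∂M ≠ ∞) (h0 : ∀ᵐ X ∂M, h X = 0 → g X = 0) :
    (M.withDensity h).withDensity (fun X => g X / h X) = M.withDensity g := by
  refine (withDensity_mul M hh (hg.div hh)).symm.trans (withDensity_congr_ae ?_)
  filter_upwards [h0, ae_lt_top hh hfin] with X hX hlt
  rcases eq_or_ne (h X) 0 with hz | hz
  · simp [hz, hX hz]
  · exact ENNReal.mul_div_cancel hz hlt.ne

theorem ae_eq_zero_of_withDensity_absolutelyContinuous (hg : Measurable g) (hh : Measurable h)
    (hac : M.withDensity g ≪ M.withDensity h) : ∀ᵐ X ∂M, h X = 0 → g X = 0 := by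
  have hs : MeasurableSet {X | h X = 0} := hh (measurableSet_singleton 0)
  have h1 : ∀ᵐ X ∂(M.withDensity h), h X ≠ 0 :=
    (ae_withDensity_iff hh).2 (Filter.Eventually.of_forall fun X hX => hX)
  filter_upwards [(ae_withDensity_iff hg).1 (hac.ae_le h1)] with X hX hz
  by_contra hne
  exact hX hne hz

theorem rnDeriv_withDensity_withDensity (hg : Measurable g) (hh : Measurable h)
    (hfin : ∫⁻ X, h X ∂M ≠ ∞) (h0 : ∀ᵐ X ∂M, h X = 0 → g X = 0) :
    (M.withDensity g).rnDeriv (M.withDensity h) =ᵐ[M.withDensity h] fun X => g X / h X := by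
  have : IsFiniteMeasure (M.withDensity h) := isFiniteMeasure_withDensity hfin
  have hr : Measurable fun X => g X / h X := hg.div hh
  have := Measure.rnDeriv_withDensity (M.withDensity h) hr
  rwa [withDensity_withDensity_div hg hh hfin h0] at this

theorem llr_withDensity_withDensity (hg : Measurable g) (hh : Measurable h)
    (hgfin : ∫⁻ X, g X ∂M ≠ ∞) (hfin : ∫⁻ X, h X ∂M ≠ ∞)
    (hac : M.withDensity g ≪ M.withDensity h) :
    ∀ᵐ X ∂(M.withDensity g), h X ≠ 0 ∧ h X ≠ ∞ ∧
      llr (M.withDensity g) (M.withDensity h) X =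
        Real.log (g X).toReal - Real.log (h X).toReal := by
  have h0 := ae_eq_zero_of_withDensity_absolutelyContinuous hg hh hac
  have h1 := (withDensity_absolutelyContinuous M g).ae_le (ae_lt_top hg hgfin)
  have h2 := (withDensity_absolutelyContinuous M g).ae_le (ae_lt_top hh hfin)
  have h3 := (withDensity_absolutelyContinuous M g).ae_le h0
  have h4 : ∀ᵐ X ∂(M.withDensity g), g X ≠ 0 :=
    (ae_withDensity_iff hg).2 (Filter.Eventually.of_forall fun X hX => hX)
  filter_upwards [h1, h2, h3, h4, hac.ae_le (rnDeriv_withDensity_withDensity hg hh hfin h0)]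
    with X h1 h2 h3 h4 h5
  have hh0 : h X ≠ 0 := fun hz => h4 (h3 hz)
  refine ⟨hh0, h2.ne, ?_⟩
  rw [llr, h5, ENNReal.toReal_div, Real.log_div]
  · exact (ENNReal.toReal_pos h4 h1.ne).ne'
  · exact (ENNReal.toReal_pos hh0 h2.ne).ne'

end Densities

/-! ### The gap between two Poisson intensities -/

/-- The nonnegative function `log (D / ν) - 1 + ν / D`, whose integral against the intensity `D`
is, up to the mass of `ν` where `D` vanishes, the divergence between Poisson processes of
intensities `D` and `ν`. -/
noncomputable def poissonGap {T : Type*} (D nu : T → ℝ≥0∞) (x : T) : ℝ :=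
  Real.log (D x).toReal - Real.log (nu x).toReal - 1 + (nu x).toReal / (D x).toReal

theorem poissonGap_nonneg {T : Type*} {D nu : T → ℝ≥0∞} {x : T}
    (hD : D x ≠ 0 ∧ D x ≠ ∞) (hnu : nu x ≠ 0 ∧ nu x ≠ ∞) :
    0 ≤ poissonGap D nu x := by
  have h1 := ENNReal.toReal_pos hD.1 hD.2
  have h2 := ENNReal.toReal_pos hnu.1 hnu.2
  have := Real.log_le_sub_one_of_pos (div_pos h2 h1)
  rw [Real.log_div h2.ne' h1.ne'] at this
  unfold poissonGap
  linarith

theorem eq_of_poissonGap_nonpos {T : Type*} {D nu : T → ℝ≥0∞} {x : T}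
    (hD : D x ≠ 0 ∧ D x ≠ ∞) (hnu : nu x ≠ 0 ∧ nu x ≠ ∞)
    (h : poissonGap D nu x ≤ 0) : nu x = D x := by
  have h1 := ENNReal.toReal_pos hD.1 hD.2
  have h2 := ENNReal.toReal_pos hnu.1 hnu.2
  by_contra hne
  have hr : (nu x).toReal / (D x).toReal ≠ 1 := by
    rw [Ne, div_eq_one_iff_eq h1.ne']
    exact fun he => hne ((ENNReal.toReal_eq_toReal_iff' hnu.2 hD.2).1 he)
  have := Real.log_lt_sub_one_of_pos (div_pos h2 h1) hr
  rw [Real.log_div h2.ne' h1.ne'] at this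
  unfold poissonGap at h
  linarith

theorem measurable_poissonGap {T : Type*} [MeasurableSpace T] {D nu : T → ℝ≥0∞}
    (hD : Measurable D) (hnu : Measurable nu) :
    Measurable (poissonGap D nu) := by
  unfold poissonGap
  fun_prop

/-! ### The best Poisson approximation has the intensity of the approximated process -/

theorem prod_ne_top_imp {T : Type*} {X : Finset T} {h : T → ℝ≥0∞} (h0 : ∏ x ∈ X, h x ≠ 0)
    (hfin : ∏ x ∈ X, h x ≠ ∞) : ∀ x ∈ X, h x ≠ 0 ∧ h x ≠ ∞ := by
  classical
  intro x hx
  rw [← Finset.mul_prod_erase X h hx] at h0 hfin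
  have h1 := mul_ne_zero_iff.1 h0
  refine ⟨h1.1, fun htop => hfin ?_⟩
  rw [htop, ENNReal.top_mul h1.2]

section BestPoisson

variable {T : Type*} [MeasurableSpace T] {μ : Measure T} {g : Finset T → ℝ≥0∞} {D nu : T → ℝ≥0∞}

theorem IsSetDensity.lintegral_eq_one (hg : IsSetDensity μ g) :
    ∫⁻ X : FiniteSubsets T, g X ∂(finsetMeasure μ) = 1 := by
  rw [lintegral_finsetMeasure μ hg.1, hg.2]

theorem IsSetDensity.isProbabilityMeasure (hg : IsSetDensity μ g) :
    IsProbabilityMeasure ((finsetMeasure μ).withDensity fun X : FiniteSubsets T => g X) :=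
  ⟨by rw [withDensity_apply _ MeasurableSet.univ, Measure.restrict_univ, hg.lintegral_eq_one]⟩

theorem log_poissonDensity {X : Finset T} (h0 : poissonDensity μ nu X ≠ 0)
    (hfin : poissonDensity μ nu X ≠ ∞) :
    (∀ x ∈ X, nu x ≠ 0 ∧ nu x ≠ ∞) ∧ Real.log (poissonDensity μ nu X).toReal =
      -(∫⁻ x, nu x ∂μ).toReal + ∑ x ∈ X, Real.log (nu x).toReal := by
  unfold poissonDensity at *
  have he : ENNReal.ofReal (Real.exp (-(∫⁻ x, nu x ∂μ).toReal)) ≠ 0 := by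
    simp [Real.exp_pos]
  have h0' := right_ne_zero_of_mul h0
  have hfin' : ∏ x ∈ X, nu x ≠ ∞ := fun htop => hfin (by rw [htop, ENNReal.mul_top he])
  have hX := prod_ne_top_imp h0' hfin'
  refine ⟨hX, ?_⟩
  rw [ENNReal.toReal_mul, ENNReal.toReal_ofReal (Real.exp_pos _).le, Real.log_mul,
    Real.log_exp, ENNReal.toReal_prod, Real.log_prod]
  · exact fun x hx => (ENNReal.toReal_pos (hX x hx).1 (hX x hx).2).ne'
  · exact (Real.exp_pos _).ne'
  · exact (ENNReal.toReal_pos h0' hfin').ne'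

variable [MeasurableEq T] [SigmaFinite μ] [NullSingletonClass μ]

/-- Campbell's formula for the law with density `g`. -/
theorem lintegral_sum_withDensity (hg : IsSetDensity μ g) (hD : phd μ g =ᵐ[μ] D)
    {h : T → ℝ≥0∞} (hh : Measurable h) :
    ∫⁻ X : FiniteSubsets T, Finset.sum X h
      ∂((finsetMeasure μ).withDensity fun X : FiniteSubsets T => g X) = ∫⁻ x, h x * D x ∂μ := by
  rw [lintegral_withDensity_eq_lintegral_mul _ hg.1 (measurable_sum_finiteSubsets hh)]
  have hm : Measurable ((fun X : FiniteSubsets T => g X) *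
      fun X : FiniteSubsets T => Finset.sum X h) :=
    hg.1.mul (measurable_sum_finiteSubsets hh)
  rw [lintegral_finsetMeasure μ hm]
  refine (setIntegral_mul_sum μ hg.1 hh).trans (lintegral_congr_ae ?_)
  filter_upwards [hD] with x hx
  rw [hx]

/-- Finite divergence forces the Poisson density to be positive and finite almost surely, so that
its logarithm is a sum over the points. -/
theorem ae_llr_poissonDensity (hg : IsSetDensity μ g) (hnu : Measurable nu)
    (hnufin : ∫⁻ x, nu x ∂μ ≠ ∞) (hkl : setKLD μ g (poissonDensity μ nu) ≠ ∞) :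
    ∀ᵐ X ∂((finsetMeasure μ).withDensity fun X : FiniteSubsets T => g X),
      (∀ x ∈ (X : Finset T), nu x ≠ 0 ∧ nu x ≠ ∞) ∧
      llr ((finsetMeasure μ).withDensity fun X : FiniteSubsets T => g X)
        ((finsetMeasure μ).withDensity fun X : FiniteSubsets T => poissonDensity μ nu X) X =
      Real.log (g X).toReal + (∫⁻ x, nu x ∂μ).toReal -
        Finset.sum X fun x => Real.log (nu x).toReal := by
  have hp := isSetDensity_poissonDensity μ hnu hnufin
  have hac := (InformationTheory.klDiv_ne_top_iff.1 hkl).1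
  have hgfin : ∫⁻ X : FiniteSubsets T, g X ∂(finsetMeasure μ) ≠ ∞ := by
    rw [hg.lintegral_eq_one]; simp
  have hpfin : ∫⁻ X : FiniteSubsets T, poissonDensity μ nu X ∂(finsetMeasure μ) ≠ ∞ := by
    rw [hp.lintegral_eq_one]; simp
  filter_upwards [llr_withDensity_withDensity (α := FiniteSubsets T) hg.1 hp.1 hgfin hpfin hac]
    with X ⟨h0, hfin, hX⟩
  obtain ⟨h1, h2⟩ := log_poissonDensity (X := (X : Finset T)) h0 hfin
  refine ⟨h1, hX.trans ?_⟩
  rw [h2]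
  ring

/-- Pythagorean identity: replacing the intensity `D` of the process by `ν` increases the
divergence from the process by the divergence between the two Poisson processes. -/
theorem setKLD_poissonDensity_eq (hg : IsSetDensity μ g) (hDm : Measurable D)
    (hD : phd μ g =ᵐ[μ] D) (hDfin : ∫⁻ x, D x ∂μ ≠ ∞)
    (hklD : setKLD μ g (poissonDensity μ D) ≠ ∞)
    (hnu : Measurable nu) (hnufin : ∫⁻ x, nu x ∂μ ≠ ∞)
    (hkl : setKLD μ g (poissonDensity μ nu) ≠ ∞) :
    ∫⁻ x, ENNReal.ofReal (poissonGap D nu x) * D x ∂μ ≠ ∞ ∧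
    (setKLD μ g (poissonDensity μ nu)).toReal = (setKLD μ g (poissonDensity μ D)).toReal +
      (∫⁻ x, ENNReal.ofReal (poissonGap D nu x) * D x ∂μ).toReal +
      (∫⁻ x in {x | D x = 0}, nu x ∂μ).toReal := by
  set P := (finsetMeasure μ).withDensity fun X : FiniteSubsets T => g X with hP
  have hprob : IsProbabilityMeasure P := hg.isProbabilityMeasure
  have hprobD := (isSetDensity_poissonDensity μ hDm hDfin).isProbabilityMeasure
  have hprobn := (isSetDensity_poissonDensity μ hnu hnufin).isProbabilityMeasure
  obtain ⟨hacD, hintD⟩ := InformationTheory.klDiv_ne_top_iff.1 hklD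
  obtain ⟨hacn, hintn⟩ := InformationTheory.klDiv_ne_top_iff.1 hkl
  have hllD := ae_llr_poissonDensity hg hDm hDfin hklD
  have hlln := ae_llr_poissonDensity hg hnu hnufin hkl
  have hgap := measurable_poissonGap hDm hnu
  have hs : MeasurableSet {x | D x = 0} := hDm (measurableSet_singleton 0)
  -- the expected sum of `ν / D` over the points is the mass of `ν` where `D ≠ 0`
  have hψm : Measurable fun x => (nu x).toReal / (D x).toReal := by fun_prop
  have hψ : ∫⁻ X : FiniteSubsets T, ENNReal.ofReal
      (Finset.sum X fun x => (nu x).toReal / (D x).toReal) ∂P =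
      ∫⁻ x in {x | D x = 0}ᶜ, nu x ∂μ := by
    have h1 : ∀ X : Finset T, ENNReal.ofReal (∑ x ∈ X, (nu x).toReal / (D x).toReal) =
        ∑ x ∈ X, ENNReal.ofReal ((nu x).toReal / (D x).toReal) := fun X =>
      ENNReal.ofReal_sum_of_nonneg fun x _ => by positivity
    refine (lintegral_congr (α := FiniteSubsets T) fun X => h1 X).trans ?_
    refine (lintegral_sum_withDensity hg hD hψm.ennreal_ofReal).trans ?_
    rw [← lintegral_indicator hs.compl]
    refine lintegral_congr_ae ?_
    filter_upwards [ae_lt_top hDm hDfin, ae_lt_top hnu hnufin] with x h1 h2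
    rcases eq_or_ne (D x) 0 with h0 | h0
    · simp [h0]
    · rw [Set.indicator_of_mem (by simpa using h0), ENNReal.ofReal_div_of_pos
        (ENNReal.toReal_pos h0 h1.ne), ENNReal.ofReal_toReal h1.ne, ENNReal.ofReal_toReal h2.ne,
        ENNReal.div_mul_cancel h0 h1.ne]
  have hψi : Integrable (fun X : FiniteSubsets T =>
      Finset.sum X fun x => (nu x).toReal / (D x).toReal) P := by
    refine (lintegral_ofReal_ne_top_iff_integrable
      (measurable_sum_finiteSubsets hψm).aestronglyMeasurable
      (Filter.Eventually.of_forall fun X => Finset.sum_nonneg (s := (X : Finset T))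
        fun x _ => by positivity)).1 ?_
    rw [hψ]
    exact ((setLIntegral_le_lintegral _ _).trans_lt hnufin.lt_top).ne
  have hψr : ∫ X : FiniteSubsets T, (Finset.sum X fun x => (nu x).toReal / (D x).toReal) ∂P =
      (∫⁻ x in {x | D x = 0}ᶜ, nu x ∂μ).toReal := by
    rw [integral_eq_lintegral_of_nonneg_ae, hψ]
    · exact Filter.Eventually.of_forall fun X => Finset.sum_nonneg (s := (X : Finset T))
        fun x _ => by positivity
    · exact (measurable_sum_finiteSubsets hψm).aestronglyMeasurable
  -- the expected number of points is the mass of `D`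
  have h1m : Measurable fun _ : T => (1 : ℝ) := measurable_const
  have hN : ∫⁻ X : FiniteSubsets T, ENNReal.ofReal (Finset.sum X fun _ => (1 : ℝ)) ∂P =
      ∫⁻ x, D x ∂μ := by
    have h1 : ∀ X : Finset T, ENNReal.ofReal (∑ x ∈ X, (1 : ℝ)) = ∑ x ∈ X, (1 : ℝ≥0∞) :=
      fun X => by simp
    refine (lintegral_congr (α := FiniteSubsets T) fun X => h1 X).trans ?_
    refine (lintegral_sum_withDensity hg hD measurable_const).trans ?_
    simp
  have hNi : Integrable (fun X : FiniteSubsets T => Finset.sum X fun _ => (1 : ℝ)) P := by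
    refine (lintegral_ofReal_ne_top_iff_integrable
      (measurable_sum_finiteSubsets h1m).aestronglyMeasurable
      (Filter.Eventually.of_forall fun X => Finset.sum_nonneg (s := (X : Finset T))
        fun x _ => by positivity)).1 ?_
    rwa [hN]
  have hNr : ∫ X : FiniteSubsets T, (Finset.sum X fun _ => (1 : ℝ)) ∂P =
      (∫⁻ x, D x ∂μ).toReal := by
    rw [integral_eq_lintegral_of_nonneg_ae, hN]
    · exact Filter.Eventually.of_forall fun X => Finset.sum_nonneg (s := (X : Finset T))
        fun x _ => by positivity
    · exact (measurable_sum_finiteSubsets h1m).aestronglyMeasurable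
  -- the sum of the gaps over the points, through the two log-likelihood ratios
  have hΦ : (fun X : FiniteSubsets T => Finset.sum X (poissonGap D nu)) =ᵐ[P] fun X =>
      llr P ((finsetMeasure μ).withDensity fun X : FiniteSubsets T => poissonDensity μ nu X) X -
      llr P ((finsetMeasure μ).withDensity fun X : FiniteSubsets T => poissonDensity μ D X) X +
      ((∫⁻ x, D x ∂μ).toReal - (∫⁻ x, nu x ∂μ).toReal) -
      (Finset.sum X fun _ => (1 : ℝ)) +
      (Finset.sum X fun x => (nu x).toReal / (D x).toReal) := by
    filter_upwards [hllD, hlln] with X h1 h2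
    rw [h1.2, h2.2]
    have hsum : ∀ X : Finset T, ∑ x ∈ X, poissonGap D nu x = ∑ x ∈ X, Real.log (D x).toReal -
        ∑ x ∈ X, Real.log (nu x).toReal - ∑ x ∈ X, 1 +
        ∑ x ∈ X, (nu x).toReal / (D x).toReal := fun X => by
      simp only [poissonGap, Finset.sum_add_distrib, Finset.sum_sub_distrib]
    refine (hsum X).trans ?_
    ring
  have hΦi : Integrable (fun X : FiniteSubsets T => Finset.sum X (poissonGap D nu)) P := by
    refine Integrable.congr ?_ hΦ.symm
    exact (((hintn.sub hintD).add (integrable_const _)).sub hNi).add hψi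
  have hΦnn : 0 ≤ᵐ[P] fun X : FiniteSubsets T => Finset.sum X (poissonGap D nu) := by
    filter_upwards [hllD, hlln] with X h1 h2
    exact Finset.sum_nonneg fun x hx => poissonGap_nonneg (h1.1 x hx) (h2.1 x hx)
  have hΦl : ∫⁻ X : FiniteSubsets T, ENNReal.ofReal (Finset.sum X (poissonGap D nu)) ∂P =
      ∫⁻ x, ENNReal.ofReal (poissonGap D nu x) * D x ∂μ := by
    rw [← lintegral_sum_withDensity hg hD hgap.ennreal_ofReal]
    refine lintegral_congr_ae ?_
    filter_upwards [hllD, hlln] with X h1 h2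
    exact ENNReal.ofReal_sum_of_nonneg fun x hx => poissonGap_nonneg (h1.1 x hx) (h2.1 x hx)
  have hΦr : ∫ X : FiniteSubsets T, Finset.sum X (poissonGap D nu) ∂P =
      (∫⁻ x, ENNReal.ofReal (poissonGap D nu x) * D x ∂μ).toReal := by
    rw [integral_eq_lintegral_of_nonneg_ae hΦnn hΦi.aestronglyMeasurable, hΦl]
  have hΦt : ∫⁻ x, ENNReal.ofReal (poissonGap D nu x) * D x ∂μ ≠ ∞ := by
    rw [← hΦl]
    exact (lintegral_ofReal_ne_top_iff_integrable hΦi.aestronglyMeasurable hΦnn).2 hΦi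
  refine ⟨hΦt, ?_⟩
  have hsplit : (∫⁻ x, nu x ∂μ).toReal = (∫⁻ x in {x | D x = 0}, nu x ∂μ).toReal +
      (∫⁻ x in {x | D x = 0}ᶜ, nu x ∂μ).toReal := by
    rw [← lintegral_add_compl nu hs, ENNReal.toReal_add]
    · exact ((setLIntegral_le_lintegral _ _).trans_lt hnufin.lt_top).ne
    · exact ((setLIntegral_le_lintegral _ _).trans_lt hnufin.lt_top).ne
  have hint := integral_congr_ae hΦ
  rw [hΦr, integral_add, integral_sub, integral_add, integral_sub hintn hintD, hNr, hψr,
    integral_const] at hint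
  · unfold setKLD
    rw [InformationTheory.toReal_klDiv_of_measure_eq hacn (by simp),
      InformationTheory.toReal_klDiv_of_measure_eq hacD (by simp)]
    simp only [probReal_univ, one_smul] at hint
    rw [hint, hsplit]
    ring
  · exact hintn.sub hintD
  · exact integrable_const _
  · exact (hintn.sub hintD).add (integrable_const _)
  · exact hNi
  · exact ((hintn.sub hintD).add (integrable_const _)).sub hNi
  · exact hψi

theorem isBestPoisson_phd (hg : IsSetDensity μ g) (hDm : Measurable D)
    (hD : phd μ g =ᵐ[μ] D) (hDfin : ∫⁻ x, D x ∂μ ≠ ∞)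
    (hklD : setKLD μ g (poissonDensity μ D) ≠ ∞) : IsBestPoisson μ g D := by
  refine ⟨hDm, hDfin, fun nu hnu hnufin => ?_⟩
  rcases eq_or_ne (setKLD μ g (poissonDensity μ nu)) ∞ with htop | hkl
  · rw [htop]; exact le_top
  · rw [← ENNReal.toReal_le_toReal hklD hkl,
      (setKLD_poissonDensity_eq hg hDm hD hDfin hklD hnu hnufin hkl).2, add_assoc]
    exact le_add_of_nonneg_right (by positivity)

/-- In the Pythagorean identity the additional divergence vanishes only if `ν = D` almost
everywhere. -/
theorem IsBestPoisson.ae_eq_phd (hg : IsSetDensity μ g) (hDm : Measurable D)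
    (hD : phd μ g =ᵐ[μ] D) (hDfin : ∫⁻ x, D x ∂μ ≠ ∞)
    (hklD : setKLD μ g (poissonDensity μ D) ≠ ∞) (h : IsBestPoisson μ g nu) :
    nu =ᵐ[μ] D := by
  obtain ⟨hnu, hnufin, hbest⟩ := h
  have hle := hbest D hDm hDfin
  have hkl : setKLD μ g (poissonDensity μ nu) ≠ ∞ := (hle.trans_lt hklD.lt_top).ne
  obtain ⟨hfin, heq⟩ := setKLD_poissonDensity_eq hg hDm hD hDfin hklD hnu hnufin hkl
  rw [← ENNReal.toReal_le_toReal hkl hklD, heq] at hle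
  have hs : MeasurableSet {x | D x = 0} := hDm (measurableSet_singleton 0)
  have hfin2 : ∫⁻ x in {x | D x = 0}, nu x ∂μ ≠ ∞ :=
    ((setLIntegral_le_lintegral _ _).trans_lt hnufin.lt_top).ne
  have hA : ∫⁻ x, ENNReal.ofReal (poissonGap D nu x) * D x ∂μ = 0 := by
    have h1 := (ENNReal.toReal_nonneg (a := ∫⁻ x in {x | D x = 0}, nu x ∂μ))
    have h2 := (ENNReal.toReal_nonneg (a := ∫⁻ x, ENNReal.ofReal (poissonGap D nu x) * D x ∂μ))
    exact (((ENNReal.toReal_eq_zero_iff _).1 (by linarith)).resolve_right hfin)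
  have hB : ∫⁻ x in {x | D x = 0}, nu x ∂μ = 0 := by
    have h1 := (ENNReal.toReal_nonneg (a := ∫⁻ x in {x | D x = 0}, nu x ∂μ))
    have h2 := (ENNReal.toReal_nonneg (a := ∫⁻ x, ENNReal.ofReal (poissonGap D nu x) * D x ∂μ))
    exact (((ENNReal.toReal_eq_zero_iff _).1 (by linarith)).resolve_right hfin2)
  -- almost no point of the process lies where `ν` vanishes
  have hs' : MeasurableSet {x | nu x = 0} := hnu (measurableSet_singleton 0)
  have hC : ∫⁻ x, Set.indicator {x | nu x = 0} 1 x * D x ∂μ = 0 := by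
    rw [← lintegral_sum_withDensity hg hD (measurable_one.indicator hs'),
      lintegral_eq_zero_iff (measurable_sum_finiteSubsets (measurable_one.indicator hs'))]
    filter_upwards [ae_llr_poissonDensity hg hnu hnufin hkl] with X hX
    exact Finset.sum_eq_zero fun x hx =>
      Set.indicator_of_notMem (s := {x | nu x = 0}) (hX.1 x hx).1 _
  replace hA := (lintegral_eq_zero_iff
    ((measurable_poissonGap hDm hnu).ennreal_ofReal.mul hDm)).1 hA
  replace hC := (lintegral_eq_zero_iff ((measurable_one.indicator hs').mul hDm)).1 hC
  rw [lintegral_eq_zero_iff hnu] at hB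
  filter_upwards [hA, hC, (ae_restrict_iff' hs).1 hB, ae_lt_top hDm hDfin,
    ae_lt_top hnu hnufin] with x hA hC hB hDt hnt
  rcases eq_or_ne (D x) 0 with h0 | h0
  · rw [h0]; exact hB h0
  · have hA' := (mul_eq_zero.1 hA).resolve_right h0
    have hC' := (mul_eq_zero.1 hC).resolve_right h0
    have hn0 : nu x ≠ 0 := by
      intro hz
      rw [Set.indicator_of_mem (s := {x | nu x = 0}) hz] at hC'
      exact one_ne_zero hC'
    exact eq_of_poissonGap_nonpos ⟨h0, hDt.ne⟩ ⟨hn0, hnt.ne⟩ (ENNReal.ofReal_eq_zero.1 hA')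

/-- The divergence from `D`-Poisson is finite when the density is dominated by that of the
Poisson process up to a factor growing geometrically with the number of points: the logarithm of
such a factor is linear in the number of points, whose expectation is finite. -/
theorem setKLD_poissonDensity_ne_top (hg : IsSetDensity μ g) (hDm : Measurable D)
    (hD : phd μ g =ᵐ[μ] D) (hDfin : ∫⁻ x, D x ∂μ ≠ ∞) {a b : ℝ} (ha : 1 ≤ a) (hb : 1 ≤ b)
    (hle : ∀ᵐ X ∂(finsetMeasure μ), g X ≤
      ENNReal.ofReal (a * b ^ Finset.card (α := T) X) * poissonDensity μ D X) :
    setKLD μ g (poissonDensity μ D) ≠ ∞ := by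
  have hp := isSetDensity_poissonDensity μ hDm hDfin
  have hprob := hg.isProbabilityMeasure
  have hprobD := hp.isProbabilityMeasure
  have hpfin : ∫⁻ X : FiniteSubsets T, poissonDensity μ D X ∂(finsetMeasure μ) ≠ ∞ := by
    rw [hp.lintegral_eq_one]; simp
  have h0 : ∀ᵐ X ∂(finsetMeasure μ), poissonDensity μ D X = 0 → g X = 0 := by
    filter_upwards [hle] with X hX hz
    rw [hz, mul_zero] at hX
    exact nonpos_iff_eq_zero.1 hX
  have hwd := withDensity_withDensity_div hg.1 hp.1 hpfin h0
  have hac : (finsetMeasure μ).withDensity (fun X : FiniteSubsets T => g X) ≪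
      (finsetMeasure μ).withDensity fun X : FiniteSubsets T => poissonDensity μ D X := by
    rw [← hwd]
    exact withDensity_absolutelyContinuous _ _
  unfold setKLD
  rw [InformationTheory.klDiv_eq_lintegral_klFun_of_ac hac]
  have hcm : Measurable fun X : FiniteSubsets T =>
      Finset.sum (X : Finset T) fun _ => ENNReal.ofReal (Real.log b) :=
    measurable_sum_finiteSubsets measurable_const
  have hrm : Measurable fun X : FiniteSubsets T => g X / poissonDensity μ D X :=
    hg.1.div hp.1
  have hbound : ∫⁻ X, ENNReal.ofReal (InformationTheory.klFun
      ((((finsetMeasure μ).withDensity fun X : FiniteSubsets T => g X).rnDeriv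
      ((finsetMeasure μ).withDensity fun X : FiniteSubsets T => poissonDensity μ D X)) X).toReal)
      ∂((finsetMeasure μ).withDensity fun X : FiniteSubsets T => poissonDensity μ D X) ≤
      ∫⁻ X : FiniteSubsets T, (g X / poissonDensity μ D X * (ENNReal.ofReal (Real.log a) +
        Finset.sum (X : Finset T) fun _ => ENNReal.ofReal (Real.log b)) + 1)
      ∂((finsetMeasure μ).withDensity fun X : FiniteSubsets T => poissonDensity μ D X) := by
    refine lintegral_mono_ae ?_
    filter_upwards [rnDeriv_withDensity_withDensity hg.1 hp.1 hpfin h0,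
      (withDensity_absolutelyContinuous _ _).ae_le hle,
      (ae_withDensity_iff hp.1).2 (Filter.Eventually.of_forall fun X hX => hX)] with X h1 h2 h3
    rw [h1]
    set n := Finset.card (α := T) X
    set r := g X / poissonDensity μ D X
    have hr : r ≤ ENNReal.ofReal (a * b ^ n) := ENNReal.div_le_of_le_mul h2
    have hrt : r ≠ ∞ := (hr.trans_lt ENNReal.ofReal_lt_top).ne
    have hab : 0 < a * b ^ n := by positivity
    have hr' : r.toReal ≤ a * b ^ n := ENNReal.toReal_le_of_le_ofReal hab.le hr
    have hla := Real.log_nonneg ha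
    have hlb := Real.log_nonneg hb
    have hkl : InformationTheory.klFun r.toReal ≤
        r.toReal * (Real.log a + n * Real.log b) + 1 := by
      rw [InformationTheory.klFun_apply]
      have hr0 : 0 ≤ r.toReal := ENNReal.toReal_nonneg
      have : r.toReal * Real.log r.toReal ≤ r.toReal * (Real.log a + n * Real.log b) := by
        rcases hr0.eq_or_lt with hz | hpos
        · rw [← hz]; simp
        · refine mul_le_mul_of_nonneg_left ?_ hr0
          refine (Real.log_le_log hpos hr').trans ?_
          rw [Real.log_mul (by positivity) (by positivity), Real.log_pow]
      linarith
    refine (ENNReal.ofReal_le_ofReal hkl).trans ?_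
    rw [ENNReal.ofReal_add (by positivity) zero_le_one, ENNReal.ofReal_one,
      ENNReal.ofReal_mul ENNReal.toReal_nonneg, ENNReal.ofReal_toReal hrt,
      ENNReal.ofReal_add hla (by positivity), ENNReal.ofReal_mul (by positivity),
      ENNReal.ofReal_natCast]
    refine le_of_eq (congrArg (fun c => r * (ENNReal.ofReal (Real.log a) + c) + 1) ?_)
    exact ((Finset.sum_const (s := (X : Finset T)) _).trans (nsmul_eq_mul _ _)).symm
  refine (hbound.trans_lt ?_).ne
  rw [lintegral_add_right _ measurable_const]
  have hfm : Measurable fun X : FiniteSubsets T => ENNReal.ofReal (Real.log a) +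
        Finset.sum (X : Finset T) fun _ => ENNReal.ofReal (Real.log b) := hcm.const_add _
  have hmul := lintegral_withDensity_eq_lintegral_mul ((finsetMeasure μ).withDensity
    fun X : FiniteSubsets T => poissonDensity μ D X) hrm hfm
  rw [hwd] at hmul
  refine ENNReal.add_lt_top.2 ⟨?_, by simp⟩
  refine lt_of_eq_of_lt hmul.symm ?_
  rw [lintegral_add_left measurable_const, lintegral_sum_withDensity hg hD measurable_const,
    lintegral_const_mul _ hDm]
  simp only [lintegral_const, measure_univ, mul_one]
  exact ENNReal.add_lt_top.2 ⟨by simp, ENNReal.mul_lt_top (by simp) hDfin.lt_top⟩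

end BestPoisson

/-! ### Sums over assignments of measurements to targets -/

section Assignments

variable {Z : Type*}

open Classical in
/-- The elements of `z` that are assigned to `a`. -/
noncomputable def originFiber {α : Type*} {z : Finset Z} (origin : z → α) (a : α) : Finset Z :=
  (Finset.univ.filter fun ζ : z => origin ζ = a).image Subtype.val

theorem mem_originFiber {α : Type*} {z : Finset Z} {origin : z → α} {a : α} {ζ : Z} :
    ζ ∈ originFiber origin a ↔ ∃ h : ζ ∈ z, origin ⟨ζ, h⟩ = a := by
  simp [originFiber]

theorem originFiber_subset {α : Type*} {z : Finset Z} (origin : z → α) (a : α) :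
    originFiber origin a ⊆ z := fun _ hζ => (mem_originFiber.1 hζ).1

theorem disjoint_originFiber {α : Type*} {z : Finset Z} (origin : z → α) {a b : α} (hab : a ≠ b) :
    Disjoint (originFiber origin a) (originFiber origin b) := by
  refine Finset.disjoint_left.2 fun ζ h1 h2 => hab ?_
  obtain ⟨_, rfl⟩ := mem_originFiber.1 h1
  exact (mem_originFiber.1 h2).2

open Classical in
/-- The sum of `C z₀ * ∏ i, φ i zᵢ` over all decompositions of `z` into disjoint, possibly empty
sets `z₀` and `zᵢ`. -/
noncomputable def assignSum {ι : Type*} [Fintype ι] (C : Finset Z → ℝ≥0∞)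
    (φ : ι → Finset Z → ℝ≥0∞) (z : Finset Z) : ℝ≥0∞ :=
  ∑ origin : (z → Option ι),
    C (originFiber origin none) * ∏ i, φ i (originFiber origin (some i))

theorem assignSum_def [DecidableEq Z] {ι : Type*} [Fintype ι] (C : Finset Z → ℝ≥0∞)
    (φ : ι → Finset Z → ℝ≥0∞) (z : Finset Z) :
    assignSum C φ z = ∑ origin : (z → Option ι),
      C (originFiber origin none) * ∏ i, φ i (originFiber origin (some i)) := by
  unfold assignSum
  congr!

theorem assignSum_comp_equiv {ι κ : Type*} [Fintype ι] [Fintype κ] (e : ι ≃ κ)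
    (C : Finset Z → ℝ≥0∞) (φ : κ → Finset Z → ℝ≥0∞) (z : Finset Z) :
    assignSum C (fun i => φ (e i)) z = assignSum C φ z := by
  classical
  unfold assignSum
  refine Fintype.sum_equiv (Equiv.arrowCongr (Equiv.refl _) (Equiv.optionCongr e)) _ _ ?_
  intro o
  have h : ∀ a, originFiber (Equiv.arrowCongr (Equiv.refl _) (Equiv.optionCongr e) o)
      (Equiv.optionCongr e a) = originFiber o a := by
    intro a
    ext ζ
    simp [mem_originFiber, (Option.map_injective e.injective).eq_iff]
  have hn := h none
  have hs := fun i => h (some i)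
  simp only [Equiv.optionCongr_apply, Option.map_none, Option.map_some] at hn hs
  rw [hn, ← Equiv.prod_comp e]
  congr 1
  exact Finset.prod_congr rfl fun i _ => by rw [hs]

theorem assignSum_const_mul {ι : Type*} [Fintype ι] (C : Finset Z → ℝ≥0∞)
    (c : ι → ℝ≥0∞) (φ : ι → Finset Z → ℝ≥0∞) (z : Finset Z) :
    assignSum C (fun i w => c i * φ i w) z = (∏ i, c i) * assignSum C φ z := by
  unfold assignSum
  rw [Finset.mul_sum]
  refine Finset.sum_congr rfl fun o _ => ?_
  rw [Finset.prod_mul_distrib, mul_left_comm]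

theorem assignSum_zero (C : Finset Z → ℝ≥0∞) (φ : Fin 0 → Finset Z → ℝ≥0∞) (z : Finset Z) :
    assignSum C φ z = C z := by
  unfold assignSum
  refine (Finset.sum_eq_single (fun _ => none)
    (fun o _ ho => absurd (funext fun ζ => Subsingleton.elim _ _) ho)
    fun h => absurd (by simp only [Finset.mem_univ]) h).trans ?_
  simp only [Finset.univ_eq_empty, Finset.prod_empty, mul_one]
  congr 1
  ext ζ
  simp only [mem_originFiber]
  exact ⟨fun h => h.1, fun h => ⟨h, trivial⟩⟩

/-- Summing first over the set assigned to the first target. -/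
theorem assignSum_succ [DecidableEq Z] {n : ℕ} (C : Finset Z → ℝ≥0∞)
    (φ : Fin (n + 1) → Finset Z → ℝ≥0∞) (z : Finset Z) :
    assignSum C φ z =
      ∑ w ∈ z.powerset, φ 0 w * assignSum C (fun i : Fin n => φ i.succ) (z \ w) := by
  simp only [assignSum_def]
  rw [← Finset.sum_fiberwise_of_maps_to (s := Finset.univ) (t := z.powerset)
    (g := fun o : z → Option (Fin (n + 1)) => originFiber o (some 0))
    (fun o _ => Finset.mem_powerset.2 (originFiber_subset o _))]
  refine Finset.sum_congr rfl fun w hw => ?_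
  rw [Finset.mem_powerset] at hw
  rw [Finset.mul_sum]
  have hmem : ∀ {o : z → Option (Fin (n + 1))}, originFiber o (some 0) = w →
      ∀ ζ (h : ζ ∈ z), ζ ∈ w ↔ o ⟨ζ, h⟩ = some 0 := by
    rintro o rfl ζ h
    rw [mem_originFiber]
    exact ⟨fun h' => h'.2, fun h' => ⟨h, h'⟩⟩
  let pred : Option (Fin (n + 1)) → Option (Fin n) := fun a =>
    a.bind (Fin.cases none some)
  have hpred : ∀ a : Option (Fin (n + 1)), a ≠ some 0 → (pred a).map Fin.succ = a := by
    rintro (_ | a) ha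
    · rfl
    · obtain ⟨b, rfl⟩ := Fin.exists_succ_eq.2 fun h => ha (congrArg some h)
      rfl
  have hpred' : ∀ a : Option (Fin n), pred (a.map Fin.succ) = a := by
    rintro (_ | a) <;> rfl
  refine Finset.sum_nbij'
    (fun o (ζ : ↥(z \ w)) => pred (o ⟨ζ, (Finset.mem_sdiff.1 ζ.2).1⟩))
    (fun o' (ζ : ↥z) => if h : (ζ : Z) ∈ w then some 0 else
      (o' ⟨ζ, Finset.mem_sdiff.2 ⟨ζ.2, h⟩⟩).map Fin.succ) ?_ ?_ ?_ ?_ ?_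
  · intro o _
    exact Finset.mem_univ _
  · intro o' _
    simp only [Finset.mem_filter, Finset.mem_univ, true_and]
    ext ζ
    rw [mem_originFiber]
    constructor
    · rintro ⟨h, h'⟩
      by_contra hζ
      rw [dif_neg hζ, Option.map_eq_some_iff] at h'
      obtain ⟨a, _, ha⟩ := h'
      exact Fin.succ_ne_zero a ha
    · intro hζ
      exact ⟨hw hζ, dif_pos hζ⟩
  · intro o ho
    simp only [Finset.mem_filter, Finset.mem_univ, true_and] at ho
    funext ζ
    by_cases hζ : (ζ : Z) ∈ w
    · rw [dif_pos hζ]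
      exact ((hmem ho ζ ζ.2).1 hζ).symm
    · rw [dif_neg hζ]
      exact hpred _ fun h => hζ ((hmem ho ζ ζ.2).2 h)
  · intro o' _
    funext ζ
    simp only
    rw [dif_neg (Finset.mem_sdiff.1 ζ.2).2]
    exact hpred' _
  · intro o ho
    simp only [Finset.mem_filter, Finset.mem_univ, true_and] at ho
    have hfib : ∀ a : Option (Fin n), originFiber (fun ζ : ↥(z \ w) =>
        pred (o ⟨ζ, (Finset.mem_sdiff.1 ζ.2).1⟩)) a = originFiber o (a.map Fin.succ) := by
      intro a
      ext ζ
      simp only [mem_originFiber]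
      constructor
      · rintro ⟨h, h'⟩
        have h1 := Finset.mem_sdiff.1 h
        refine ⟨h1.1, ?_⟩
        rw [← h']
        exact (hpred _ fun h0 => h1.2 ((hmem ho ζ h1.1).2 h0)).symm
      · rintro ⟨h, h'⟩
        refine ⟨Finset.mem_sdiff.2 ⟨h, fun hζ => ?_⟩, ?_⟩
        · have h0 := (hmem ho ζ h).1 hζ
          rw [h'] at h0
          rw [Option.map_eq_some_iff] at h0
          obtain ⟨b, _, hb⟩ := h0
          exact Fin.succ_ne_zero b hb
        · rw [h', hpred']
    rw [Fin.prod_univ_succ, ho, hfib none]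
    simp only [hfib]
    rw [mul_left_comm]
    rfl

end Assignments

/-! ### The exponential series of the cell weights -/

section Series

variable {Z : Type*}

/-- The weight of the measurement set `u` when the number of targets is averaged out: the sum over
`n` of `1 / n!` times the sum over all assignments of `u` to clutter and `n` targets, each target
generating the set `w` with weight `τ w`. -/
noncomputable def assignSeries (C τ : Finset Z → ℝ≥0∞) (u : Finset Z) : ℝ≥0∞ :=
  ∑' n : ℕ, ((n.factorial : ℕ) : ℝ≥0∞)⁻¹ * assignSum C (fun _ : Fin n => τ) u

variable {C τ : Finset Z → ℝ≥0∞} {c : Z → ℝ≥0∞}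

/-- Conditioning on the origin of the measurement `a` when there are `n` targets. For `n = 0` the
subtraction `n - 1` is harmless, as the second term has the factor `n`. -/
theorem assignSum_const_eq_of_mem [DecidableEq Z]
    (hC : ∀ u, ∀ a ∈ u, C u = c a * C (u.erase a)) (n : ℕ) :
    ∀ u : Finset Z, ∀ a ∈ u, assignSum C (fun _ : Fin n => τ) u =
      c a * assignSum C (fun _ : Fin n => τ) (u.erase a) +
        n * ∑ w ∈ u.powerset with a ∈ w, τ w * assignSum C (fun _ : Fin (n - 1) => τ) (u \ w) := by
  induction n with
  | zero =>
    intro u a ha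
    rw [assignSum_zero, assignSum_zero, hC u a ha]
    simp
  | succ n ih =>
    intro u a ha
    have hpow : u.powerset.filter (fun w => a ∉ w) = (u.erase a).powerset := by
      ext w
      simp only [Finset.mem_filter, Finset.mem_powerset, Finset.subset_erase]
    have hstep : ∀ w ∈ (u.erase a).powerset,
        τ w * assignSum C (fun _ : Fin n => τ) (u \ w) =
        c a * (τ w * assignSum C (fun _ : Fin n => τ) (u.erase a \ w)) +
        n * ∑ v ∈ (u \ w).powerset with a ∈ v,
          τ v * (τ w * assignSum C (fun _ : Fin (n - 1) => τ) ((u \ v) \ w)) := by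
      intro w hw
      rw [Finset.mem_powerset, Finset.subset_erase] at hw
      rw [ih (u \ w) a (Finset.mem_sdiff.2 ⟨ha, hw.2⟩), Finset.erase_sdiff_comm, mul_add,
        mul_left_comm, mul_left_comm (τ w) (n : ℝ≥0∞), Finset.mul_sum]
      congr 2
      refine Finset.sum_congr rfl fun v _ => ?_
      rw [mul_left_comm, sdiff_right_comm]
    have hswap : ∑ w ∈ (u.erase a).powerset, ∑ v ∈ (u \ w).powerset with a ∈ v,
          τ v * (τ w * assignSum C (fun _ : Fin (n - 1) => τ) ((u \ v) \ w)) =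
        ∑ v ∈ u.powerset with a ∈ v, ∑ w ∈ (u \ v).powerset,
          τ v * (τ w * assignSum C (fun _ : Fin (n - 1) => τ) ((u \ v) \ w)) := by
      refine Finset.sum_comm' fun w v => ?_
      simp only [Finset.mem_powerset, Finset.mem_filter, Finset.subset_erase,
        Finset.subset_sdiff]
      constructor
      · rintro ⟨⟨h1, h2⟩, ⟨h3, h4⟩, h5⟩
        exact ⟨⟨h1, h4.symm⟩, h3, h5⟩
      · rintro ⟨⟨h1, h4⟩, h3, h5⟩
        exact ⟨⟨h1, fun h => Finset.disjoint_left.1 h4 h h5⟩, ⟨h3, h4.symm⟩, h5⟩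
    have hn : (n : ℝ≥0∞) * ∑ v ∈ u.powerset with a ∈ v, ∑ w ∈ (u \ v).powerset,
          τ v * (τ w * assignSum C (fun _ : Fin (n - 1) => τ) ((u \ v) \ w)) =
        n * ∑ v ∈ u.powerset with a ∈ v, τ v * assignSum C (fun _ : Fin n => τ) (u \ v) := by
      cases n with
      | zero => simp
      | succ n =>
        congr 1
        refine Finset.sum_congr rfl fun v _ => ?_
        rw [← Finset.mul_sum, assignSum_succ]
        rfl
    rw [assignSum_succ, ← Finset.sum_filter_add_sum_filter_not _ (fun w => a ∈ w), hpow,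
      Finset.sum_congr rfl hstep, Finset.sum_add_distrib, ← Finset.mul_sum, ← Finset.mul_sum,
      hswap, hn, ← assignSum_succ C (fun _ : Fin (n + 1) => τ) (u.erase a)]
    push_cast
    rw [Nat.add_sub_cancel]
    ring

/-- Conditioning on the origin of the measurement `a`, which is clutter or belongs to the set of
measurements of some target. -/
theorem assignSeries_eq_of_mem [DecidableEq Z]
    (hC : ∀ u, ∀ a ∈ u, C u = c a * C (u.erase a)) {u : Finset Z} {a : Z} (ha : a ∈ u) :
    assignSeries C τ u = c a * assignSeries C τ (u.erase a) +
      ∑ w ∈ u.powerset with a ∈ w, τ w * assignSeries C τ (u \ w) := by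
  have h1 : ∀ n : ℕ, ((n.factorial : ℕ) : ℝ≥0∞)⁻¹ * assignSum C (fun _ : Fin n => τ) u =
      c a * (((n.factorial : ℕ) : ℝ≥0∞)⁻¹ * assignSum C (fun _ : Fin n => τ) (u.erase a)) +
      ((n.factorial : ℕ) : ℝ≥0∞)⁻¹ * n * ∑ w ∈ u.powerset with a ∈ w,
        τ w * assignSum C (fun _ : Fin (n - 1) => τ) (u \ w) := by
    intro n
    rw [assignSum_const_eq_of_mem hC n u a ha]
    ring
  have h2 : ∑' n : ℕ, ((n.factorial : ℕ) : ℝ≥0∞)⁻¹ * n * ∑ w ∈ u.powerset with a ∈ w,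
        τ w * assignSum C (fun _ : Fin (n - 1) => τ) (u \ w) =
      ∑ w ∈ u.powerset with a ∈ w, τ w * assignSeries C τ (u \ w) := by
    rw [tsum_eq_zero_add' ENNReal.summable]
    simp only [Nat.cast_zero, mul_zero, zero_mul, zero_add, inv_factorial_succ_mul]
    simp_rw [Finset.mul_sum]
    rw [Summable.tsum_finsetSum fun _ _ => ENNReal.summable]
    refine Finset.sum_congr rfl fun w _ => ?_
    rw [assignSeries, ← ENNReal.tsum_mul_left]
    exact tsum_congr fun n => mul_left_comm _ _ _
  have h3 : assignSeries C τ u = ∑' n : ℕ,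
      ((n.factorial : ℕ) : ℝ≥0∞)⁻¹ * assignSum C (fun _ : Fin n => τ) u := rfl
  rw [h3, tsum_congr h1, ENNReal.summable.tsum_add ENNReal.summable, h2, ENNReal.tsum_mul_left]
  rfl

theorem assignSeries_ne_zero_of_clutter {u : Finset Z} (h : C u ≠ 0) :
    assignSeries C τ u ≠ 0 := by
  intro h0
  have := ENNReal.tsum_eq_zero.1 h0 0
  rw [assignSum_zero] at this
  simp [h] at this

theorem assignSeries_union_ne_zero [DecidableEq Z] {u w : Finset Z} (h : assignSeries C τ u ≠ 0)
    (hw : τ w ≠ 0) (hd : Disjoint u w) : assignSeries C τ (u ∪ w) ≠ 0 := by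
  intro h0
  refine h (ENNReal.tsum_eq_zero.2 fun n => ?_)
  have h1 := ENNReal.tsum_eq_zero.1 h0 (n + 1)
  have h2 := (mul_eq_zero.1 h1).resolve_left (by simp)
  rw [assignSum_succ] at h2
  have h3 := Finset.sum_eq_zero_iff.1 h2 w
    (Finset.mem_powerset.2 Finset.subset_union_right)
  rw [Finset.union_sdiff_right, hd.sdiff_eq_left] at h3
  rw [(mul_eq_zero.1 h3).resolve_left hw, mul_zero]

theorem le_assignSeries {u : Finset Z} {n : ℕ} (origin : u → Option (Fin n)) :
    ((n.factorial : ℕ) : ℝ≥0∞)⁻¹ * (C (originFiber origin none) *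
      ∏ i, τ (originFiber origin (some i))) ≤ assignSeries C τ u := by
  classical
  refine le_trans ?_ (ENNReal.le_tsum n)
  gcongr
  unfold assignSum
  exact Finset.single_le_sum (f := fun o : u → Option (Fin n) => C (originFiber o none) *
      ∏ i, τ (originFiber o (some i))) (fun _ _ => zero_le) (Finset.mem_univ origin)

/-- The sets assigned to the other targets and to clutter have positive joint weight. -/
theorem assignSeries_sdiff_originFiber_ne_zero [DecidableEq Z] {z : Finset Z} {n : ℕ}
    (origin : z → Option (Fin n)) (hC : C (originFiber origin none) ≠ 0)
    (hτ : ∀ i, τ (originFiber origin (some i)) ≠ 0) (i : Fin n) :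
    assignSeries C τ (z \ originFiber origin (some i)) ≠ 0 := by
  have key : ∀ s : Finset (Fin n), assignSeries C τ (originFiber origin none ∪
      s.biUnion fun i => originFiber origin (some i)) ≠ 0 := by
    intro s
    induction s using Finset.induction_on with
    | empty => simpa using assignSeries_ne_zero_of_clutter hC
    | insert i s his ih =>
      have : originFiber origin none ∪ (insert i s).biUnion (fun i => originFiber origin (some i))
          = (originFiber origin none ∪ s.biUnion fun i => originFiber origin (some i)) ∪
            originFiber origin (some i) := by
        rw [Finset.biUnion_insert, Finset.union_comm (originFiber origin (some i)),
          Finset.union_assoc]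
      rw [this]
      refine assignSeries_union_ne_zero ih (hτ i) (Finset.disjoint_union_left.2
        ⟨disjoint_originFiber origin (by simp), (Finset.disjoint_biUnion_left _ _ _).2 ?_⟩)
      intro j hj
      refine disjoint_originFiber origin fun h => his ?_
      rw [← Option.some_injective _ h]
      exact hj
  have heq : z \ originFiber origin (some i) = originFiber origin none ∪
      (Finset.univ.erase i).biUnion fun i => originFiber origin (some i) := by
    ext ζ
    simp only [Finset.mem_sdiff, mem_originFiber, Finset.mem_union, Finset.mem_biUnion,
      Finset.mem_erase, Finset.mem_univ, and_true]
    constructor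
    · rintro ⟨h, h'⟩
      rcases ho : origin ⟨ζ, h⟩ with _ | j
      · exact Or.inl ⟨h, ho⟩
      · refine Or.inr ⟨j, ?_, h, ho⟩
        rintro rfl
        exact h' ⟨h, ho⟩
    · rintro (⟨h, ho⟩ | ⟨j, hj, h, ho⟩)
      · refine ⟨h, fun ⟨_, h'⟩ => ?_⟩
        simp [ho] at h'
      · refine ⟨h, fun ⟨_, h'⟩ => hj ?_⟩
        rw [ho] at h'
        exact Option.some_injective _ h'
  rw [heq]
  exact key _

/-- If each target weight `φ i w` is dominated by `d i` relative to the weight of the remaining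
measurements, then the sum over assignments is at most `∏ i, d i` up to a factor growing
geometrically with the number of targets. -/
theorem assignSum_le_geometric [DecidableEq Z] (z : Finset Z) (hfin : assignSeries C τ z ≠ ∞) :
    ∃ a b : ℝ, 1 ≤ a ∧ 1 ≤ b ∧ ∀ (n : ℕ) (φ : Fin n → Finset Z → ℝ≥0∞) (d : Fin n → ℝ≥0∞),
      (∀ i, ∀ w ⊆ z, τ w = 0 → φ i w = 0) →
      (∀ i, ∀ w ⊆ z, φ i w * assignSeries C τ (z \ w) ≤ assignSeries C τ z * d i) →
      (∀ i, d i ≠ ∞) →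
      assignSum C φ z ≤ ENNReal.ofReal (a * b ^ n) * ∏ i, d i := by
  classical
  set S := assignSeries C τ with hS
  -- only sets of finite clutter weight and of remainder with positive weight contribute
  set A : ℝ≥0∞ := 1 + ∑ u ∈ z.powerset, if C u = ∞ then 0 else C u with hA
  set K : ℝ≥0∞ := 1 + ∑ w ∈ z.powerset, if S (z \ w) = 0 then 0 else S z / S (z \ w) with hK
  have hAt : A ≠ ∞ := by
    refine ENNReal.add_ne_top.2 ⟨by simp, ENNReal.sum_ne_top.2 fun u _ => ?_⟩
    split_ifs with h
    · simp
    · exact h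
  have hKt : K ≠ ∞ := by
    refine ENNReal.add_ne_top.2 ⟨by simp, ENNReal.sum_ne_top.2 fun u _ => ?_⟩
    split_ifs with h
    · simp
    · exact ENNReal.div_ne_top hfin h
  have hA1 : 1 ≤ A.toReal := by
    rw [← ENNReal.toReal_one]; exact ENNReal.toReal_mono hAt le_self_add
  have hK1 : 1 ≤ K.toReal := by
    rw [← ENNReal.toReal_one]; exact ENNReal.toReal_mono hKt le_self_add
  refine ⟨A.toReal, 2 ^ z.card * K.toReal, hA1,
    one_le_mul_of_one_le_of_one_le (one_le_pow₀ one_le_two) hK1, ?_⟩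
  intro n φ d h1 h2 h3
  have hterm : ∀ o : z → Option (Fin n), C (originFiber o none) *
      ∏ i, φ i (originFiber o (some i)) ≤ A * (K ^ n * ∏ i, d i) := by
    intro o
    rcases eq_or_ne (C (originFiber o none) * ∏ i, φ i (originFiber o (some i))) 0 with h0 | h0
    · rw [h0]; exact zero_le
    have hC0 := left_ne_zero_of_mul h0
    have hφ0 := Finset.prod_ne_zero_iff.1 (right_ne_zero_of_mul h0)
    have hτ0 : ∀ i, τ (originFiber o (some i)) ≠ 0 := fun i hz =>
      hφ0 i (Finset.mem_univ i) (h1 i _ (originFiber_subset o _) hz)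
    have hCt : C (originFiber o none) ≠ ∞ := by
      intro htop
      have := le_assignSeries (C := C) (τ := τ) o
      rw [htop, ENNReal.top_mul (Finset.prod_ne_zero_iff.2 fun i _ => hτ0 i),
        ENNReal.mul_top (by simp)] at this
      exact hfin (top_le_iff.1 this)
    refine mul_le_mul' ?_ ?_
    · refine le_trans ?_ le_add_self
      refine le_trans ?_ (Finset.single_le_sum (f := fun u => if C u = ∞ then 0 else C u)
        (fun _ _ => zero_le) (Finset.mem_powerset.2 (originFiber_subset o none)))
      simp only [hCt, if_false, le_refl]
    · have hpow : K ^ n * ∏ i, d i = ∏ i : Fin n, K * d i := by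
        rw [Finset.prod_mul_distrib, Finset.prod_const, Finset.card_univ, Fintype.card_fin]
      rw [hpow]
      refine Finset.prod_le_prod' fun i _ => ?_
      have hSi := assignSeries_sdiff_originFiber_ne_zero o hC0 hτ0 i
      have hle : S z / S (z \ originFiber o (some i)) ≤ K := by
        refine le_trans ?_ le_add_self
        refine le_trans ?_ (Finset.single_le_sum
          (f := fun w => if S (z \ w) = 0 then 0 else S z / S (z \ w))
          (fun _ _ => zero_le) (Finset.mem_powerset.2 (originFiber_subset o (some i))))
        simp only [hS, hSi, if_false, le_refl]
      calc φ i (originFiber o (some i))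
          ≤ S z * d i / S (z \ originFiber o (some i)) := by
            rw [ENNReal.le_div_iff_mul_le (Or.inl hSi)
              (Or.inr (ENNReal.mul_ne_top hfin (h3 i)))]
            exact h2 i _ (originFiber_subset o _)
        _ = S z / S (z \ originFiber o (some i)) * d i := by
            rw [div_eq_mul_inv, div_eq_mul_inv, mul_right_comm]
        _ ≤ K * d i := by gcongr
  calc assignSum C φ z ≤ ∑ _o : z → Option (Fin n), A * (K ^ n * ∏ i, d i) :=
        (assignSum_def C φ z).trans_le (Finset.sum_le_sum fun o _ => hterm o)
    _ = ((n + 1 : ℕ) : ℝ≥0∞) ^ z.card * (A * (K ^ n * ∏ i, d i)) := by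
        rw [Finset.sum_const, nsmul_eq_mul, Finset.card_univ, Fintype.card_fun]
        simp
    _ ≤ ((2 : ℝ≥0∞) ^ n) ^ z.card * (A * (K ^ n * ∏ i, d i)) := by
        gcongr
        exact_mod_cast Nat.lt_two_pow_self
    _ = ENNReal.ofReal (A.toReal * (2 ^ z.card * K.toReal) ^ n) * ∏ i, d i := by
        rw [ENNReal.ofReal_mul (by positivity), ENNReal.ofReal_toReal hAt,
          ENNReal.ofReal_pow (by positivity), ENNReal.ofReal_mul (by positivity),
          ENNReal.ofReal_toReal hKt, ENNReal.ofReal_pow (by positivity), mul_pow, ← pow_mul,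
          ← pow_mul, mul_comm n]
        simp only [ENNReal.ofReal_ofNat]
        ring

end Series

/-! ### Sums over partitions -/

section Partitions

variable {Z : Type*} [DecidableEq Z] {r : Finset Z → ℝ≥0∞}

/-- The sum over the partitions of `u` of the products of the weights of their cells. -/
noncomputable def partitionSum (r : Finset Z → ℝ≥0∞) (u : Finset Z) : ℝ≥0∞ :=
  ∑ Q : Finpartition u, ∏ w ∈ Q.parts, r w

/-- Partitions of `u` with the cell `w` are the partitions of `u \ w` with the cell `w` added. -/
theorem sum_prod_parts_of_mem {u w : Finset Z} (hw : w ⊆ u) (hne : w.Nonempty) :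
    ∑ P : Finpartition u with w ∈ P.parts, ∏ v ∈ P.parts, r v =
      r w * partitionSum r (u \ w) := by
  have hbot : w ≠ ⊥ := hne.ne_empty
  have hnot : ∀ Q : Finpartition (u \ w), w ∉ Q.parts := fun Q hQ => by
    obtain ⟨a, ha⟩ := hne
    exact (Finset.mem_sdiff.1 (Q.le hQ ha)).2 ha
  have hsup : u \ w ⊔ w = u := sdiff_sup_cancel hw
  have herase : ∀ P : Finpartition u, w ∈ P.parts → (P.parts.erase w).sup id = u \ w := by
    intro P hP
    have hd : Disjoint w ((P.parts.erase w).sup id) :=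
      P.supIndep (Finset.erase_subset w P.parts) hP (Finset.notMem_erase w P.parts)
    have hs : w ⊔ (P.parts.erase w).sup id = u := by
      refine Eq.trans ?_ P.sup_parts
      conv_rhs => rw [← Finset.insert_erase hP, Finset.sup_insert]
      rfl
    refine Eq.trans ?_ (congrArg (· \ w) hs)
    simp only [sup_sdiff_left_self, hd.symm.sdiff_eq_left]
  unfold partitionSum
  rw [Finset.mul_sum]
  refine Finset.sum_bij'
    (fun P hP => P.ofSubset (Finset.erase_subset w P.parts)
      (herase P (Finset.mem_filter.1 hP).2))
    (fun Q _ => Q.extend hbot disjoint_sdiff_self_left hsup) ?_ ?_ ?_ ?_ ?_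
  · intro P _
    exact Finset.mem_univ _
  · intro Q _
    simp [Finpartition.extend]
  · intro P hP
    ext1
    simp only [Finpartition.extend, Finpartition.ofSubset]
    exact Finset.insert_erase (Finset.mem_filter.1 hP).2
  · intro Q _
    ext1
    simp only [Finpartition.extend, Finpartition.ofSubset]
    exact Finset.erase_insert (hnot Q)
  · intro P hP
    simp only [Finpartition.ofSubset]
    exact (Finset.mul_prod_erase _ _ (Finset.mem_filter.1 hP).2).symm

theorem partitionSum_empty : partitionSum r ∅ = 1 := by
  unfold partitionSum
  have : Unique (Finpartition (∅ : Finset Z)) := inferInstanceAs (Unique (Finpartition ⊥))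
  rw [Fintype.sum_unique]
  have : (default : Finpartition (∅ : Finset Z)).parts = ∅ :=
    Finpartition.parts_eq_empty_iff.2 rfl
  rw [this, Finset.prod_empty]

/-- Grouping the partitions by the cell of `a`. -/
theorem partitionSum_eq_of_mem {u : Finset Z} {a : Z} (ha : a ∈ u) :
    partitionSum r u = ∑ w ∈ u.powerset with a ∈ w, r w * partitionSum r (u \ w) := by
  have h1 : ∀ w ∈ u.powerset.filter (fun w => a ∈ w), r w * partitionSum r (u \ w) =
      ∑ P : Finpartition u with w ∈ P.parts, ∏ v ∈ P.parts, r v := by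
    intro w hw
    rw [Finset.mem_filter, Finset.mem_powerset] at hw
    exact (sum_prod_parts_of_mem hw.1 ⟨a, hw.2⟩).symm
  rw [Finset.sum_congr rfl h1]
  unfold partitionSum
  rw [Finset.sum_congr rfl fun (P : Finpartition u) _ =>
    (show ∏ w ∈ P.parts, r w = ∑ w ∈ ({P.part a} : Finset (Finset Z)), ∏ w ∈ P.parts, r w by simp)]
  refine Finset.sum_comm' fun P w => ?_
  simp only [Finset.mem_univ, true_and, Finset.mem_singleton, Finset.mem_filter,
    Finset.mem_powerset]
  constructor
  · rintro rfl
    exact ⟨P.part_mem.2 ha, P.part_subset a, P.mem_part ha⟩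
  · rintro ⟨h1, h2, h3⟩
    exact (P.part_eq_of_mem h1 h3).symm

/-- The exponential formula: the weight of `u` with the number of targets averaged out is a sum
over the partitions of `u`, up to the weight of the empty set. -/
theorem assignSeries_eq_partitionSum {C τ : Finset Z → ℝ≥0∞} {c : Z → ℝ≥0∞}
    (hC : ∀ u, ∀ a ∈ u, C u = c a * C (u.erase a)) (u : Finset Z) :
    assignSeries C τ u =
      assignSeries C τ ∅ * partitionSum (fun w => kappaCell c w + τ w) u := by
  induction u using Finset.strongInduction with
  | H u ih =>
    rcases u.eq_empty_or_nonempty with rfl | ⟨a, ha⟩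
    · rw [partitionSum_empty, mul_one]
    have hsub : ∀ w ∈ u.powerset.filter (fun w => a ∈ w), u \ w ⊂ u := by
      intro w hw
      rw [Finset.mem_filter, Finset.mem_powerset] at hw
      exact Finset.sdiff_ssubset hw.1 ⟨a, hw.2⟩
    have hsingle : ∑ w ∈ u.powerset with a ∈ w,
        kappaCell c w * partitionSum (fun w => kappaCell c w + τ w) (u \ w) =
        c a * partitionSum (fun w => kappaCell c w + τ w) (u.erase a) := by
      rw [Finset.sum_eq_single {a}]
      · simp [kappaCell, Finset.sdiff_singleton_eq_erase]
      · intro w hw hne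
        rw [Finset.mem_filter] at hw
        have : w.card ≠ 1 := by
          intro hcard
          obtain ⟨b, rfl⟩ := Finset.card_eq_one.1 hcard
          rw [Finset.mem_singleton.1 hw.2] at hne
          exact hne rfl
        simp [kappaCell, this]
      · intro h
        simp [ha] at h
    rw [assignSeries_eq_of_mem hC ha, partitionSum_eq_of_mem ha, ih _ (Finset.erase_ssubset ha),
      Finset.sum_congr rfl fun w hw => by rw [ih _ (hsub w hw)]]
    simp_rw [add_mul]
    rw [Finset.sum_add_distrib, hsingle, mul_add, Finset.mul_sum]
    congr 1
    · ring
    · exact Finset.sum_congr rfl fun w _ => mul_left_comm _ _ _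

end Partitions

/-! ### Disjoint unions of measurable spaces -/

section Sigma

variable {ι : Type*} {α : ι → Type*} [∀ i, MeasurableSpace (α i)]

theorem measurableSet_sigma {s : Set (Σ i, α i)} :
    MeasurableSet s ↔ ∀ i, MeasurableSet (Sigma.mk i ⁻¹' s) :=
  MeasurableSpace.measurableSet_iInf

theorem measurable_sigma_of_comp {β : Type*} [MeasurableSpace β] {f : (Σ i, α i) → β}
    (h : ∀ i, Measurable fun x : α i => f ⟨i, x⟩) : Measurable f :=
  fun _ hs => measurableSet_sigma.2 fun i => h i hs

theorem measurableEmbedding_sigmaMk (i : ι) : MeasurableEmbedding (Sigma.mk (β := α) i) where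
  injective := sigma_mk_injective
  measurable := fun _ hs => measurableSet_sigma.1 hs i
  measurableSet_image' := by
    classical
    intro s hs
    refine measurableSet_sigma.2 fun j => ?_
    by_cases hij : i = j
    · subst hij
      rwa [Set.preimage_image_eq _ sigma_mk_injective]
    · rw [Set.preimage_image_sigmaMk_of_ne (Ne.symm hij)]
      exact MeasurableSet.empty

theorem measurableEq_sigma [Countable ι] [∀ i, MeasurableEq (α i)] :
    MeasurableEq (Σ i, α i) := by
  constructor
  have : Set.diagonal (Σ i, α i) = ⋃ i, Prod.map (Sigma.mk i) (Sigma.mk i) ''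
      Set.diagonal (α i) := by
    ext ⟨⟨i, x⟩, ⟨j, y⟩⟩
    simp only [Set.mem_diagonal_iff, Set.mem_iUnion, Set.mem_image, Prod.exists, Prod.map_apply,
      Prod.mk.injEq]
    constructor
    · intro h
      exact ⟨i, x, x, rfl, rfl, h⟩
    · rintro ⟨m, a, b, rfl, h1, h2⟩
      exact h1.symm.trans h2
  rw [this]
  exact MeasurableSet.iUnion fun i => ((measurableEmbedding_sigmaMk i).prodMap
    (measurableEmbedding_sigmaMk i)).measurableSet_image.2 measurableSet_diagonal

end Sigma

/-! ### The space of trajectories -/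

section Trajectories

variable {k nx : ℕ}

instance TrajIndex.finite (k : ℕ) : Finite (TrajIndex k) := by
  refine Set.Finite.subset ((Set.finite_Iic (k + 1)).prod (Set.finite_Iic (k + 1))) ?_
  rintro ⟨a, b⟩ ⟨h1, h2, h3⟩
  simp only [Set.mem_prod, Set.mem_Iic] at *
  omega

instance Trajectory.measurableEq : MeasurableEq (Trajectory k nx) := measurableEq_sigma

instance trajMeasure.sigmaFinite : SigmaFinite (trajMeasure k nx) := by
  unfold trajMeasure
  have : ∀ p : TrajIndex k, SigmaFinite (Measure.map (Sigma.mk p)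
      (volume : Measure (Fin p.1.2 → TargetState nx))) := fun p =>
    (measurableEmbedding_sigmaMk (α := fun p : TrajIndex k => Fin p.1.2 → TargetState nx)
      p).sigmaFinite_map
  infer_instance

theorem measurable_lastState : Measurable (Trajectory.lastState (k := k) (nx := nx)) :=
  measurable_sigma_of_comp fun p => measurable_pi_apply
    (⟨p.1.2 - 1, by have h := p.2.2.1; omega⟩ : Fin p.1.2)

theorem measurableSet_isAlive : MeasurableSet {X : Trajectory k nx | X.IsAlive} := by
  refine measurableSet_sigma.2 fun p => ?_
  exact MeasurableSet.const (p.1.1 + p.1.2 = k + 1)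

theorem trajMeasure_preimage_lastState (hnx : 0 < nx) (e : TargetState nx) :
    trajMeasure k nx (Trajectory.lastState ⁻¹' {e}) = 0 := by
  have : Nonempty (Fin nx) := ⟨⟨0, hnx⟩⟩
  have hs : MeasurableSet (Trajectory.lastState (k := k) ⁻¹' {e}) :=
    measurable_lastState (measurableSet_singleton e)
  unfold trajMeasure
  rw [Measure.sum_apply _ hs, ENNReal.tsum_eq_zero]
  intro p
  rw [Measure.map_apply (measurableEmbedding_sigmaMk p).measurable hs]
  exact Measure.pi_hyperplane (fun _ : Fin p.1.2 => (volume : Measure (TargetState nx)))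
    ⟨p.1.2 - 1, by have h := p.2.2.1; omega⟩ e

theorem nullSingletonClass_trajMeasure (hnx : 0 < nx) :
    NullSingletonClass (trajMeasure k nx) :=
  ⟨fun X => measure_mono_null (s := {X}) (by rintro _ rfl; rfl)
    (trajMeasure_preimage_lastState hnx X.lastState)⟩

theorem lintegral_trajMeasure {g : Trajectory k nx → ℝ≥0∞} (hg : Measurable g) :
    ∫⁻ X, g X ∂(trajMeasure k nx) =
      ∑' p : TrajIndex k, ∫⁻ y : Fin p.1.2 → TargetState nx, g ⟨p, y⟩ := by
  unfold trajMeasure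
  rw [lintegral_sum_measure]
  exact tsum_congr fun p => lintegral_map hg (measurableEmbedding_sigmaMk p).measurable

/-- The PHD of the current targets is the image of the trajectory PHD under the last state. -/
theorem lintegral_mul_targetPHD {lam : Trajectory k nx → ℝ≥0∞} (hlam : Measurable lam)
    (hlam_alive : ∀ X : Trajectory k nx, ¬ X.IsAlive → lam X = 0)
    {g : TargetState nx → ℝ≥0∞} (hg : Measurable g) :
    ∫⁻ x, g x * targetPHD lam x = ∫⁻ X, g X.lastState * lam X ∂(trajMeasure k nx) := by
  let e : Fin k → TrajIndex k := fun j =>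
    ⟨(k - (j : ℕ), (j : ℕ) + 1), by have h := j.2; simp only; omega⟩
  have he : Function.Injective e := by
    intro i j hij
    have := congrArg (fun p : TrajIndex k => p.1.2) hij
    simp only [e] at this
    exact Fin.ext (by omega)
  have hgl : Measurable fun X : Trajectory k nx => g X.lastState * lam X :=
    (hg.comp measurable_lastState).mul hlam
  rw [lintegral_trajMeasure hgl, ← he.tsum_eq, tsum_fintype]
  · have hj : ∀ j : Fin k, Measurable fun q : TargetState nx × (Fin (j : ℕ) → TargetState nx) =>
        lam ⟨e j, Fin.snoc (α := fun _ => TargetState nx) q.2 q.1⟩ := by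
      intro j
      have h1 : Measurable fun y : Fin ((j : ℕ) + 1) → TargetState nx => lam ⟨e j, y⟩ :=
        hlam.comp (measurableEmbedding_sigmaMk (e j)).measurable
      have h2 := h1.comp (MeasurableEquiv.piFinSuccAbove
        (fun _ : Fin ((j : ℕ) + 1) => TargetState nx) (Fin.last j)).symm.measurable
      convert h2 using 1
      funext q
      exact congrArg (fun y => lam ⟨e j, y⟩) (Fin.insertNth_last' q.1 q.2).symm
    have hj' : ∀ j : Fin k, Measurable fun x => g x * ∫⁻ y : Fin (j : ℕ) → TargetState nx,
        lam ⟨e j, Fin.snoc (α := fun _ => TargetState nx) y x⟩ := fun j =>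
      hg.mul ((hj j).lintegral_prod_right' (ν := volume))
    unfold targetPHD
    simp_rw [Finset.mul_sum]
    refine (lintegral_finsetSum _ fun j _ => hj' j).trans ?_
    refine Finset.sum_congr rfl fun j _ => ?_
    have hm : Measurable fun y : Fin ((j : ℕ) + 1) → TargetState nx =>
        g (y (Fin.last j)) * lam ⟨e j, y⟩ := by
      have h1 : Measurable fun y : Fin ((j : ℕ) + 1) → TargetState nx => lam ⟨e j, y⟩ :=
        hlam.comp (measurableEmbedding_sigmaMk (e j)).measurable
      exact (hg.comp (measurable_pi_apply (Fin.last (j : ℕ)))).mul h1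
    refine Eq.trans ?_ (lintegral_pi_insertNth (volume : Measure (TargetState nx))
      (Fin.last j) hm).symm
    refine lintegral_congr fun x => ?_
    have hx : Measurable fun y : Fin (j : ℕ) → TargetState nx =>
        lam ⟨e j, Fin.snoc (α := fun _ => TargetState nx) y x⟩ :=
      (hj j).comp measurable_prodMk_left
    refine (lintegral_const_mul (g x) hx).symm.trans (lintegral_congr fun y => ?_)
    rw [Fin.insertNth_apply_same, Fin.insertNth_last']
  · -- every other index belongs to trajectories that have ended
    intro p hp
    by_contra hr
    refine hp ?_
    have hdead : p.1.1 + p.1.2 ≠ k + 1 := by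
      intro hal
      refine hr ⟨⟨p.1.2 - 1, ?_⟩, ?_⟩
      · have := p.2; omega
      · have := p.2
        refine Subtype.ext (Prod.ext ?_ ?_) <;> simp only [e] <;> omega
    refine (lintegral_congr fun y => ?_).trans lintegral_zero
    rw [hlam_alive ⟨p, y⟩ hdead, mul_zero]

end Trajectories

/-! ### The likelihood of tuples of trajectories -/

theorem phd_eq_tsum {T : Type*} [MeasurableSpace T] (μ : Measure T) (g : Finset T → ℝ≥0∞)
    (x : T) : phd μ g x = ∑' n : ℕ, ((n.factorial : ℕ) : ℝ≥0∞)⁻¹ *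
      ∫⁻ y : Fin n → T, g (tupleSet (n + 1) ((0 : Fin (n + 1)).insertNth (α := fun _ => T) x y))
        ∂(Measure.pi fun _ => μ) := by
  unfold phd setIntegral
  exact tsum_congr fun n => congrArg _ (lintegral_congr fun y =>
    congrArg g (tupleSet_insertNth 0 x y).symm)

section Likelihood

theorem ae_injective_lastState {k nx : ℕ} (hnx : 0 < nx) (n : ℕ) :
    ∀ᵐ x ∂(Measure.pi fun _ : Fin n => trajMeasure k nx),
      Function.Injective fun i => (x i).lastState :=
  ae_injective_comp _ measurable_lastState (trajMeasure_preimage_lastState hnx) n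

variable {k nx : ℕ} {Z : Type*} {f : TargetState nx → Finset Z → ℝ≥0∞}
  {lamC : Z → ℝ≥0∞} {lam : Trajectory k nx → ℝ≥0∞}

theorem measurable_assignSum {ι : Type*} [Fintype ι] {α : Type*} [MeasurableSpace α]
    (C : Finset Z → ℝ≥0∞) {φ : α → ι → Finset Z → ℝ≥0∞}
    (hφ : ∀ i w, Measurable fun x => φ x i w) (z : Finset Z) :
    Measurable fun x => assignSum C (φ x) z := by
  unfold assignSum
  exact Finset.measurable_sum _ fun o _ =>
    (Finset.measurable_prod _ fun i _ => hφ i _).const_mul _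

/-- The weight with which the trajectory `X` occurs and generates the measurement set `w`. -/
noncomputable def detectionWeight (f : TargetState nx → Finset Z → ℝ≥0∞)
    (lam : Trajectory k nx → ℝ≥0∞) (X : Trajectory k nx) (w : Finset Z) : ℝ≥0∞ :=
  lam X * f X.lastState w

/-- The total weight with which some trajectory generates the measurement set `w`. -/
noncomputable def cellWeight (f : TargetState nx → Finset Z → ℝ≥0∞)
    (lam : Trajectory k nx → ℝ≥0∞) (w : Finset Z) : ℝ≥0∞ :=
  ∫⁻ X, detectionWeight f lam X w ∂(trajMeasure k nx)

theorem measurable_detectionWeight (hf : ∀ w, Measurable fun x => f x w) (hlam : Measurable lam)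
    (w : Finset Z) : Measurable fun X => detectionWeight f lam X w :=
  hlam.mul ((hf w).comp measurable_lastState)

theorem tauCell_targetPHD (hf : ∀ w, Measurable fun x => f x w) (hlam : Measurable lam)
    (hlam_alive : ∀ X : Trajectory k nx, ¬ X.IsAlive → lam X = 0) (w : Finset Z) :
    tauCell f (targetPHD lam) w = cellWeight f lam w := by
  unfold tauCell cellWeight detectionWeight
  rw [lintegral_mul_targetPHD hlam hlam_alive (hf w)]
  simp_rw [mul_comm]

theorem lintegral_assignSum_detectionWeight (hf : ∀ w, Measurable fun x => f x w)
    (hlam : Measurable lam) (C : Finset Z → ℝ≥0∞) (z : Finset Z) (n : ℕ) :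
    ∫⁻ x : Fin n → Trajectory k nx, assignSum C (fun i => detectionWeight f lam (x i)) z
        ∂(Measure.pi fun _ => trajMeasure k nx) =
      assignSum C (fun _ : Fin n => cellWeight f lam) z := by
  have hm : ∀ w, Measurable fun X => detectionWeight f lam X w :=
    measurable_detectionWeight hf hlam
  unfold assignSum
  have hm' : ∀ o : z → Option (Fin n), Measurable fun x : Fin n → Trajectory k nx =>
      ∏ i, detectionWeight f lam (x i) (originFiber o (some i)) := fun o =>
    Finset.measurable_prod _ fun i _ => (hm _).comp (measurable_pi_apply i)
  rw [lintegral_finsetSum _ fun o _ => (hm' o).const_mul _]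
  refine Finset.sum_congr rfl fun o _ => ?_
  rw [lintegral_const_mul _ (hm' o)]
  congr 1
  exact lintegral_pi_prod _ fun i => hm _

variable [MeasureSpace Z]

theorem poissonDensity_eq_mul_erase [DecidableEq Z] (u : Finset Z) (a : Z) (ha : a ∈ u) :
    poissonDensity volume lamC u = lamC a * poissonDensity volume lamC (u.erase a) := by
  unfold poissonDensity
  rw [← Finset.mul_prod_erase u lamC ha, mul_left_comm]

open Classical in
theorem targetLikelihood_image {ι : Type*} [Fintype ι] (z : Finset Z) {y : ι → TargetState nx}
    (hy : Function.Injective y) :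
    targetLikelihood f lamC z (Finset.univ.image y) =
      assignSum (poissonDensity volume lamC) (fun i => f (y i)) z := by
  let e : ι ≃ ↥(Finset.univ.image y) := Equiv.ofBijective
    (fun i => ⟨y i, Finset.mem_image_of_mem y (Finset.mem_univ i)⟩)
    ⟨fun i j hij => hy (congrArg Subtype.val hij), fun ⟨ξ, hξ⟩ => by
      obtain ⟨i, _, rfl⟩ := Finset.mem_image.1 hξ
      exact ⟨i, rfl⟩⟩
  refine Eq.trans ?_ (assignSum_comp_equiv e (poissonDensity volume lamC)
    (fun ξ : ↥(Finset.univ.image y) => f ξ) z).symm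
  unfold targetLikelihood assignSum originFiber
  congr!

theorem measurable_trajLikelihood (hf : ∀ w, Measurable fun x => f x w) (z : Finset Z) :
    Measurable fun X : FiniteSubsets (Trajectory k nx) => trajLikelihood f lamC z X := by
  classical
  have hm := measurable_image_filter (measurableSet_isAlive (k := k)) measurable_lastState
    (targetLikelihood f lamC z) fun ι _ =>
      ⟨fun y => assignSum (poissonDensity volume lamC) (fun i => f (y i)) z,
        measurable_assignSum _ (fun i w => (hf w).comp (measurable_pi_apply i)) z,
        fun y hy => by convert (targetLikelihood_image z hy).symm⟩
  have heq : ∀ X : Finset (Trajectory k nx), trajLikelihood f lamC z X =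
      targetLikelihood f lamC z (@Finset.image _ _ (fun a b => Classical.propDecidable (a = b))
        Trajectory.lastState (@Finset.filter _ Trajectory.IsAlive
          (fun a => Classical.propDecidable _) X)) := by
    intro X
    unfold trajLikelihood currentTargets
    congr!
  exact (funext heq : (fun X : FiniteSubsets (Trajectory k nx) => trajLikelihood f lamC z X) = _)
    ▸ hm

/-- If some trajectory has ended, it does not enter the likelihood, but then both sides vanish. -/
theorem trajLikelihood_mul_prior (hlam_alive : ∀ X : Trajectory k nx, ¬ X.IsAlive → lam X = 0)
    (z : Finset Z) {n : ℕ} {x : Fin n → Trajectory k nx}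
    (hx : Function.Injective fun i => (x i).lastState) :
    trajLikelihood f lamC z (tupleSet n x) *
        poissonDensity (trajMeasure k nx) lam (tupleSet n x) =
      ENNReal.ofReal (Real.exp (-(∫⁻ X, lam X ∂(trajMeasure k nx)).toReal)) *
        assignSum (poissonDensity volume lamC) (fun i => detectionWeight f lam (x i)) z := by
  classical
  have hx' : Function.Injective x := fun i j hij => hx (congrArg Trajectory.lastState hij)
  have hprior : poissonDensity (trajMeasure k nx) lam (tupleSet n x) =
      ENNReal.ofReal (Real.exp (-(∫⁻ X, lam X ∂(trajMeasure k nx)).toReal)) *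
        ∏ i, lam (x i) :=
    congrArg (ENNReal.ofReal (Real.exp (-(∫⁻ X, lam X ∂(trajMeasure k nx)).toReal)) * ·)
      (prod_tupleSet hx' lam)
  have hassign : assignSum (poissonDensity volume lamC)
      (fun i => detectionWeight f lam (x i)) z = (∏ i, lam (x i)) *
        assignSum (poissonDensity volume lamC) (fun i => f (x i).lastState) z :=
    assignSum_const_mul _ (fun i => lam (x i)) (fun i => f (x i).lastState) z
  rw [hprior, hassign]
  by_cases halive : ∀ i, (x i).IsAlive
  · have hcur : currentTargets (tupleSet n x : Finset (Trajectory k nx)) =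
        Finset.univ.image fun i => (x i).lastState := by
      ext ξ
      simp only [currentTargets, tupleSet, Finset.mem_image, Finset.mem_filter, Finset.mem_univ,
        true_and]
      constructor
      · rintro ⟨_, ⟨⟨i, rfl⟩, _⟩, rfl⟩
        exact ⟨i, rfl⟩
      · rintro ⟨i, rfl⟩
        exact ⟨x i, ⟨⟨i, rfl⟩, halive i⟩, rfl⟩
    have hl : trajLikelihood f lamC z (tupleSet n x) =
        assignSum (poissonDensity volume lamC) (fun i => f (x i).lastState) z := by
      refine (congrArg (targetLikelihood f lamC z) hcur).trans ?_
      convert targetLikelihood_image z hx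
    rw [hl]
    ring
  · push Not at halive
    obtain ⟨i, hi⟩ := halive
    rw [Finset.prod_eq_zero (Finset.mem_univ i) (hlam_alive _ hi)]
    simp

/-- The prior enters Bayes' rule only through the weights of the cells. -/
theorem evidence_eq (hnx : 0 < nx) (hf : ∀ w, Measurable fun x => f x w) (hlam : Measurable lam)
    (hlam_alive : ∀ X : Trajectory k nx, ¬ X.IsAlive → lam X = 0) (z : Finset Z) :
    evidence f lamC z (poissonDensity (trajMeasure k nx) lam) =
      ENNReal.ofReal (Real.exp (-(∫⁻ X, lam X ∂(trajMeasure k nx)).toReal)) *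
        assignSeries (poissonDensity volume lamC) (cellWeight f lam) z := by
  unfold evidence setIntegral assignSeries
  rw [← ENNReal.tsum_mul_left]
  refine tsum_congr fun n => ?_
  rw [mul_left_comm]
  congr 1
  rw [← lintegral_assignSum_detectionWeight hf hlam, ← lintegral_const_mul']
  · refine lintegral_congr_ae ?_
    filter_upwards [ae_injective_lastState hnx n] with x hx
    exact trajLikelihood_mul_prior hlam_alive z hx
  · exact ENNReal.ofReal_ne_top

/-- The posterior density at a tuple of trajectories with distinct last states. -/
theorem posterior_tupleSet (hnx : 0 < nx) (hf : ∀ w, Measurable fun x => f x w)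
    (hlam : Measurable lam) (hlam_alive : ∀ X : Trajectory k nx, ¬ X.IsAlive → lam X = 0)
    (z : Finset Z) {n : ℕ} {x : Fin n → Trajectory k nx}
    (hx : Function.Injective fun i => (x i).lastState) :
    posterior f lamC z (poissonDensity (trajMeasure k nx) lam) (tupleSet n x) =
      assignSum (poissonDensity volume lamC) (fun i => detectionWeight f lam (x i)) z /
        assignSeries (poissonDensity volume lamC) (cellWeight f lam) z := by
  have h := trajLikelihood_mul_prior (f := f) (lamC := lamC) hlam_alive z hx
  refine (congrArg (· / evidence f lamC z (poissonDensity (trajMeasure k nx) lam)) h).trans ?_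
  rw [evidence_eq hnx hf hlam hlam_alive]
  exact ENNReal.mul_div_mul_left _ _ (by simp [Real.exp_pos]) ENNReal.ofReal_ne_top

theorem isSetDensity_posterior (hf : ∀ w, Measurable fun x => f x w) (hlam : Measurable lam)
    (z : Finset Z) (hz_pos : evidence f lamC z (poissonDensity (trajMeasure k nx) lam) ≠ 0)
    (hz_fin : evidence f lamC z (poissonDensity (trajMeasure k nx) lam) ≠ ∞) :
    IsSetDensity (trajMeasure k nx)
      (posterior f lamC z (poissonDensity (trajMeasure k nx) lam)) := by
  refine ⟨((measurable_trajLikelihood hf z).mul (measurable_poissonDensity _ hlam)).div_const _,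
    ?_⟩
  have hinv : (evidence f lamC z (poissonDensity (trajMeasure k nx) lam))⁻¹ ≠ ∞ :=
    ENNReal.inv_ne_top.2 hz_pos
  refine Eq.trans ?_ (ENNReal.mul_inv_cancel hz_pos hz_fin)
  conv_rhs => enter [1]; unfold evidence
  unfold setIntegral
  rw [← ENNReal.tsum_mul_right]
  refine tsum_congr fun n => ?_
  rw [mul_assoc, ← lintegral_mul_const' _ _ hinv]
  rfl

theorem lintegral_posterior_insertNth [DecidableEq Z] (hnx : 0 < nx)
    (hf : ∀ w, Measurable fun x => f x w) (hlam : Measurable lam)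
    (hlam_alive : ∀ X : Trajectory k nx, ¬ X.IsAlive → lam X = 0)
    (z : Finset Z) (X : Trajectory k nx) (n : ℕ) :
    ∫⁻ y : Fin n → Trajectory k nx, posterior f lamC z (poissonDensity (trajMeasure k nx) lam)
        (tupleSet (n + 1) ((0 : Fin (n + 1)).insertNth (α := fun _ => Trajectory k nx) X y))
        ∂(Measure.pi fun _ => trajMeasure k nx) =
      (∑ w ∈ z.powerset, detectionWeight f lam X w *
        assignSum (poissonDensity volume lamC) (fun _ : Fin n => cellWeight f lam) (z \ w)) *
        (assignSeries (poissonDensity volume lamC) (cellWeight f lam) z)⁻¹ := by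
  have hm : ∀ u, Measurable fun y : Fin n → Trajectory k nx =>
      assignSum (poissonDensity volume lamC) (fun i => detectionWeight f lam (y i)) u := fun u =>
    measurable_assignSum _ (fun i w =>
      (measurable_detectionWeight hf hlam w).comp (measurable_pi_apply i)) u
  have hne : ∀ᵐ y ∂(Measure.pi fun _ : Fin n => trajMeasure k nx),
      ∀ i, (y i).lastState ≠ X.lastState := by
    refine ae_all_iff.2 fun i => ?_
    exact (Measure.tendsto_eval_ae_ae (μ := fun _ : Fin n => trajMeasure k nx)
      (i := i)).eventually (measure_eq_zero_iff_ae_notMem.1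
      (trajMeasure_preimage_lastState (k := k) hnx X.lastState))
  have hcongr : ∫⁻ y : Fin n → Trajectory k nx,
      posterior f lamC z (poissonDensity (trajMeasure k nx) lam)
        (tupleSet (n + 1) ((0 : Fin (n + 1)).insertNth (α := fun _ => Trajectory k nx) X y))
        ∂(Measure.pi fun _ => trajMeasure k nx) =
      ∫⁻ y : Fin n → Trajectory k nx, (∑ w ∈ z.powerset, detectionWeight f lam X w *
        assignSum (poissonDensity volume lamC) (fun i => detectionWeight f lam (y i)) (z \ w)) *
        (assignSeries (poissonDensity volume lamC) (cellWeight f lam) z)⁻¹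
        ∂(Measure.pi fun _ => trajMeasure k nx) := by
    refine lintegral_congr_ae ?_
    filter_upwards [ae_injective_lastState hnx n, hne] with y hy hyX
    have hinj : Function.Injective fun i =>
        ((0 : Fin (n + 1)).insertNth (α := fun _ => Trajectory k nx) X y i).lastState := by
      have heq : (fun i => ((0 : Fin (n + 1)).insertNth (α := fun _ => Trajectory k nx) X y
          i).lastState) = Fin.cons X.lastState fun i => (y i).lastState := by
        funext i
        refine Fin.cases ?_ (fun i => ?_) i <;> simp
      rw [heq, Fin.cons_injective_iff]
      refine ⟨?_, hy⟩
      rintro ⟨i, hi⟩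
      exact hyX i hi
    rw [posterior_tupleSet hnx hf hlam hlam_alive z hinj, assignSum_succ, div_eq_mul_inv]
    simp only [Fin.insertNth_zero, Fin.cons_zero, Fin.cons_succ]
    rfl
  rw [hcongr, lintegral_mul_const _ (Finset.measurable_sum _ fun w _ => (hm _).const_mul _),
    lintegral_finsetSum _ fun w _ => (hm _).const_mul _]
  congr 1
  refine Finset.sum_congr rfl fun w _ => ?_
  rw [lintegral_const_mul _ (hm _), lintegral_assignSum_detectionWeight hf hlam]

/-- The PHD of the posterior: the trajectory generates some set `w` of measurements, and clutter
and the other trajectories generate the remaining ones. -/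
theorem phd_posterior [DecidableEq Z] (hnx : 0 < nx) (hf : ∀ w, Measurable fun x => f x w)
    (hlam : Measurable lam) (hlam_alive : ∀ X : Trajectory k nx, ¬ X.IsAlive → lam X = 0)
    (z : Finset Z) (X : Trajectory k nx) :
    phd (trajMeasure k nx) (posterior f lamC z (poissonDensity (trajMeasure k nx) lam)) X =
      (∑ w ∈ z.powerset, detectionWeight f lam X w *
        assignSeries (poissonDensity volume lamC) (cellWeight f lam) (z \ w)) /
        assignSeries (poissonDensity volume lamC) (cellWeight f lam) z := by
  rw [phd_eq_tsum]
  simp only [lintegral_posterior_insertNth hnx hf hlam hlam_alive z X]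
  simp_rw [← mul_assoc]
  rw [ENNReal.tsum_mul_right, div_eq_mul_inv]
  congr 1
  simp_rw [Finset.mul_sum]
  rw [Summable.tsum_finsetSum fun _ _ => ENNReal.summable]
  refine Finset.sum_congr rfl fun w _ => ?_
  unfold assignSeries
  rw [← ENNReal.tsum_mul_left]
  exact tsum_congr fun n => mul_left_comm _ _ _

end Likelihood

/-! ### The updated PHD is the PHD of the posterior -/

section Update

variable {k nx : ℕ} {Z : Type*} {f : TargetState nx → Finset Z → ℝ≥0∞}
  {lamC : Z → ℝ≥0∞} {lam : Trajectory k nx → ℝ≥0∞}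

theorem mul_partitionSum_sdiff_le [DecidableEq Z] {r : Finset Z → ℝ≥0∞} {z w : Finset Z}
    (hw : w ⊆ z) (hne : w.Nonempty) : r w * partitionSum r (z \ w) ≤ partitionSum r z := by
  rw [← sum_prod_parts_of_mem hw hne]
  exact Finset.sum_le_sum_of_subset (Finset.filter_subset _ _)

theorem ae_detectionWeight_eq_zero (hf : ∀ w, Measurable fun x => f x w) (hlam : Measurable lam)
    (z : Finset Z) : ∀ᵐ X ∂(trajMeasure k nx), ∀ w ⊆ z, cellWeight f lam w = 0 →
      detectionWeight f lam X w = 0 := by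
  have h : ∀ᵐ X ∂(trajMeasure k nx), ∀ w : z.powerset, cellWeight f lam w = 0 →
      detectionWeight f lam X w = 0 := by
    refine ae_all_iff.2 fun w => ?_
    by_cases hw : cellWeight f lam w = 0
    · filter_upwards [(lintegral_eq_zero_iff (measurable_detectionWeight hf hlam w)).1 hw]
        with X hX _ using hX
    · exact Filter.Eventually.of_forall fun X h => absurd h hw
  filter_upwards [h] with X hX w hw using hX ⟨w, Finset.mem_powerset.2 hw⟩

theorem measurable_pseudoLikelihood (hf : ∀ w, Measurable fun x => f x w)
    (lamT : TargetState nx → ℝ≥0∞) (z : Finset Z) :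
    Measurable fun x => pseudoLikelihood f lamC lamT z x := by
  unfold pseudoLikelihood
  exact (hf ∅).add (Finset.measurable_sum _ fun P _ =>
    (Finset.measurable_sum _ fun w _ => (hf w).div_const _).const_mul _)

theorem measurable_updatedPHD (hf : ∀ w, Measurable fun x => f x w) (hlam : Measurable lam)
    (z : Finset Z) : Measurable (updatedPHD f lamC lam z) := by
  unfold updatedPHD
  exact Measurable.ite measurableSet_isAlive
    (((measurable_pseudoLikelihood hf _ z).comp measurable_lastState).mul hlam) measurable_const

/-- The terms of the pseudolikelihood, grouped by the cell assigned to the target. -/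
theorem mul_pseudoLikelihood [DecidableEq Z] {lamT : TargetState nx → ℝ≥0∞} {z : Finset Z}
    (hG0 : partitionSum (fun w => kappaCell lamC w + tauCell f lamT w) z ≠ 0)
    (hGt : partitionSum (fun w => kappaCell lamC w + tauCell f lamT w) z ≠ ∞)
    {x : TargetState nx} {c : ℝ≥0∞}
    (hc : ∀ w ⊆ z, tauCell f lamT w = 0 → c * f x w = 0) :
    c * pseudoLikelihood f lamC lamT z x = (∑ w ∈ z.powerset, c * f x w *
      partitionSum (fun w => kappaCell lamC w + tauCell f lamT w) (z \ w)) /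
      partitionSum (fun w => kappaCell lamC w + tauCell f lamT w) z := by
  classical
  set r : Finset Z → ℝ≥0∞ := fun w => kappaCell lamC w + tauCell f lamT w with hr
  have hpseudo : pseudoLikelihood f lamC lamT z x = f x ∅ + ∑ P : Finpartition z,
      (∏ w ∈ P.parts, r w) / partitionSum r z * ∑ w ∈ P.parts, f x w / r w := by
    unfold pseudoLikelihood partitionWeight partitionSum
    congr!
  have hswap : ∑ P : Finpartition z,
      (∏ w ∈ P.parts, r w) / partitionSum r z * ∑ w ∈ P.parts, f x w / r w =
      ∑ w ∈ z.powerset.erase ∅, r w * partitionSum r (z \ w) / partitionSum r z *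
        (f x w / r w) := by
    simp_rw [Finset.mul_sum]
    have hcomm : ∑ P : Finpartition z, ∑ w ∈ P.parts,
        (∏ w ∈ P.parts, r w) / partitionSum r z * (f x w / r w) =
        ∑ w ∈ z.powerset.erase ∅, ∑ P : Finpartition z with w ∈ P.parts,
          (∏ w ∈ P.parts, r w) / partitionSum r z * (f x w / r w) := by
      refine Finset.sum_comm' fun P w => ?_
      simp only [Finset.mem_univ, true_and, Finset.mem_filter, Finset.mem_erase,
        Finset.mem_powerset]
      exact ⟨fun h => ⟨h, P.ne_bot h, P.le h⟩, fun h => h.1⟩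
    rw [hcomm]
    refine Finset.sum_congr rfl fun w hw => ?_
    rw [Finset.mem_erase, Finset.mem_powerset] at hw
    rw [← sum_prod_parts_of_mem hw.2 (Finset.nonempty_iff_ne_empty.2 hw.1)]
    simp_rw [div_eq_mul_inv, Finset.sum_mul]
  have hcell : ∀ w ∈ z.powerset.erase ∅, c * (r w * partitionSum r (z \ w) / partitionSum r z *
      (f x w / r w)) = c * f x w * partitionSum r (z \ w) / partitionSum r z := by
    intro w hw
    rw [Finset.mem_erase, Finset.mem_powerset] at hw
    have hne := Finset.nonempty_iff_ne_empty.2 hw.1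
    rcases eq_or_ne (r w) 0 with h0 | h0
    · have hτ : tauCell f lamT w = 0 := (add_eq_zero.1 h0).2
      simp [h0, hc w hw.2 hτ]
    rcases eq_or_ne (r w) ∞ with ht | ht
    · -- an infinite cell weight is only compatible with a finite sum if the rest has weight zero
      have hz : partitionSum r (z \ w) = 0 := by
        by_contra hz
        have hle := mul_partitionSum_sdiff_le (r := r) hw.2 hne
        rw [ht, ENNReal.top_mul hz] at hle
        exact hGt (top_le_iff.1 hle)
      simp [hz]
    · rw [div_eq_mul_inv, div_eq_mul_inv, div_eq_mul_inv]
      calc c * (r w * partitionSum r (z \ w) * (partitionSum r z)⁻¹ * (f x w * (r w)⁻¹))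
          = (r w * (r w)⁻¹) * (c * f x w * partitionSum r (z \ w) * (partitionSum r z)⁻¹) := by
            ring
        _ = _ := by rw [ENNReal.mul_inv_cancel h0 ht, one_mul]
  rw [hpseudo, hswap, mul_add, Finset.mul_sum, Finset.sum_congr rfl hcell]
  rw [← Finset.add_sum_erase z.powerset _ (Finset.empty_mem_powerset z), ENNReal.add_div,
    Finset.sdiff_empty, ENNReal.mul_div_cancel_right hG0 hGt]
  simp_rw [div_eq_mul_inv, Finset.sum_mul]

variable [MeasureSpace Z]

/-- The updated PHD in terms of the weights `assignSeries` of the measurements that are left to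
clutter and to the other trajectories. -/
theorem updatedPHD_ae_eq [DecidableEq Z] (hf : ∀ w, Measurable fun x => f x w)
    (hlam : Measurable lam) (hlam_alive : ∀ X : Trajectory k nx, ¬ X.IsAlive → lam X = 0)
    {z : Finset Z} (h0 : assignSeries (poissonDensity volume lamC) (cellWeight f lam) z ≠ 0)
    (ht : assignSeries (poissonDensity volume lamC) (cellWeight f lam) z ≠ ∞) :
    updatedPHD f lamC lam z =ᵐ[trajMeasure k nx] fun X =>
      (∑ w ∈ z.powerset, detectionWeight f lam X w *
        assignSeries (poissonDensity volume lamC) (cellWeight f lam) (z \ w)) /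
        assignSeries (poissonDensity volume lamC) (cellWeight f lam) z := by
  have hS := assignSeries_eq_partitionSum (C := poissonDensity volume lamC)
    (τ := cellWeight f lam) (poissonDensity_eq_mul_erase (lamC := lamC))
  have hr : (fun w => kappaCell lamC w + tauCell f (targetPHD lam) w) =
      fun w => kappaCell lamC w + cellWeight f lam w := by
    funext w
    rw [tauCell_targetPHD hf hlam hlam_alive]
  have hzS := hS z
  have hG0 : partitionSum (fun w => kappaCell lamC w + cellWeight f lam w) z ≠ 0 := fun h => by
    rw [h, mul_zero] at hzS
    exact h0 hzS
  have hE0 : assignSeries (poissonDensity volume lamC) (cellWeight f lam) ∅ ≠ 0 := fun h => by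
    rw [h, zero_mul] at hzS
    exact h0 hzS
  have hEt : assignSeries (poissonDensity volume lamC) (cellWeight f lam) ∅ ≠ ∞ := fun h => by
    rw [h, ENNReal.top_mul hG0] at hzS
    exact ht hzS
  have hGt : partitionSum (fun w => kappaCell lamC w + cellWeight f lam w) z ≠ ∞ := fun h => by
    rw [h, ENNReal.mul_top hE0] at hzS
    exact ht hzS
  filter_upwards [ae_detectionWeight_eq_zero hf hlam z] with X hX
  by_cases hal : X.IsAlive
  · have hsum : ∑ w ∈ z.powerset, detectionWeight f lam X w *
        assignSeries (poissonDensity volume lamC) (cellWeight f lam) (z \ w) =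
        assignSeries (poissonDensity volume lamC) (cellWeight f lam) ∅ *
          ∑ w ∈ z.powerset, lam X * f X.lastState w *
            partitionSum (fun w => kappaCell lamC w + cellWeight f lam w) (z \ w) := by
      rw [Finset.mul_sum]
      refine Finset.sum_congr rfl fun w _ => ?_
      rw [hS (z \ w), mul_left_comm]
      rfl
    unfold updatedPHD
    rw [if_pos hal, mul_comm, mul_pseudoLikelihood (by rwa [hr]) (by rwa [hr])
      (fun w hw hτ => hX w hw (by rwa [← tauCell_targetPHD hf hlam hlam_alive])), hr, hsum, hS z,
      ENNReal.mul_div_mul_left _ _ hE0 hEt]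
  · unfold updatedPHD
    rw [if_neg hal, Finset.sum_eq_zero]
    · simp
    · intro w _
      rw [detectionWeight, hlam_alive X hal]
      simp

/-- The expected number of posterior trajectories is finite: undetected ones are bounded by the
prior mass, and the number of detected ones by that of the measurements. -/
theorem lintegral_updatedPHD_ne_top (hf : ∀ w, Measurable fun x => f x w)
    (hf_empty : ∀ x, f x ∅ ≤ 1) (hlam : Measurable lam)
    (hlam_fin : ∫⁻ X, lam X ∂(trajMeasure k nx) ≠ ∞)
    (hlam_alive : ∀ X : Trajectory k nx, ¬ X.IsAlive → lam X = 0)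
    {z : Finset Z} (h0 : assignSeries (poissonDensity volume lamC) (cellWeight f lam) z ≠ 0)
    (ht : assignSeries (poissonDensity volume lamC) (cellWeight f lam) z ≠ ∞) :
    ∫⁻ X, updatedPHD f lamC lam z X ∂(trajMeasure k nx) ≠ ∞ := by
  classical
  have hm := measurable_detectionWeight (f := f) hf hlam
  have hS := assignSeries_eq_partitionSum (C := poissonDensity volume lamC)
    (τ := cellWeight f lam) (poissonDensity_eq_mul_erase (lamC := lamC))
  rw [lintegral_congr_ae (updatedPHD_ae_eq hf hlam hlam_alive h0 ht)]
  simp_rw [div_eq_mul_inv]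
  rw [lintegral_mul_const _ (Finset.measurable_sum _ fun w _ => (hm w).mul_const _),
    lintegral_finsetSum _ fun w _ => (hm w).mul_const _]
  refine ENNReal.mul_ne_top (ENNReal.sum_ne_top.2 fun w hw => ?_) (ENNReal.inv_ne_top.2 h0)
  rw [lintegral_mul_const _ (hm w)]
  rw [Finset.mem_powerset] at hw
  rcases w.eq_empty_or_nonempty with rfl | hne
  · rw [Finset.sdiff_empty]
    refine ENNReal.mul_ne_top (ne_top_of_le_ne_top hlam_fin (lintegral_mono fun X => ?_)) ht
    exact (mul_le_mul' le_rfl (hf_empty _)).trans (mul_one _).le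
  · refine ne_top_of_le_ne_top ht ?_
    rw [hS (z \ w), hS z, mul_left_comm]
    refine mul_le_mul' le_rfl (le_trans ?_ (mul_partitionSum_sdiff_le hw hne))
    exact mul_le_mul' le_add_self le_rfl

theorem IsSetDensity.apply_empty_le_one {T : Type*} [MeasurableSpace T] {μ : Measure T}
    [SigmaFinite μ] {g : Finset T → ℝ≥0∞} (hg : IsSetDensity μ g) : g ∅ ≤ 1 := by
  rw [← hg.2]
  refine le_trans ?_ (ENNReal.le_tsum 0)
  simp [tupleSet]

/-- The divergence from the posterior to the Poisson process with the updated PHD is finite. -/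
theorem setKLD_posterior_ne_top (hnx : 0 < nx) (hf : ∀ w, Measurable fun x => f x w)
    (hf_empty : ∀ x, f x ∅ ≤ 1) (hlam : Measurable lam)
    (hlam_fin : ∫⁻ X, lam X ∂(trajMeasure k nx) ≠ ∞)
    (hlam_alive : ∀ X : Trajectory k nx, ¬ X.IsAlive → lam X = 0) (z : Finset Z)
    (hg : IsSetDensity (trajMeasure k nx)
      (posterior f lamC z (poissonDensity (trajMeasure k nx) lam)))
    (hD : phd (trajMeasure k nx) (posterior f lamC z (poissonDensity (trajMeasure k nx) lam))
      =ᵐ[trajMeasure k nx] updatedPHD f lamC lam z)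
    (h0 : assignSeries (poissonDensity volume lamC) (cellWeight f lam) z ≠ 0)
    (ht : assignSeries (poissonDensity volume lamC) (cellWeight f lam) z ≠ ∞) :
    setKLD (trajMeasure k nx) (posterior f lamC z (poissonDensity (trajMeasure k nx) lam))
      (poissonDensity (trajMeasure k nx) (updatedPHD f lamC lam z)) ≠ ∞ := by
  classical
  have hnull : NullSingletonClass (trajMeasure k nx) := nullSingletonClass_trajMeasure hnx
  have hDm := measurable_updatedPHD (lamC := lamC) hf hlam z
  have hDfin := lintegral_updatedPHD_ne_top hf hf_empty hlam hlam_fin hlam_alive h0 ht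
  obtain ⟨a, b, ha, hb, hbound⟩ := assignSum_le_geometric z ht
  set S := assignSeries (poissonDensity volume lamC) (cellWeight f lam) with hSdef
  set m := (∫⁻ X, updatedPHD f lamC lam z X ∂(trajMeasure k nx)).toReal with hmdef
  have hm0 : 0 ≤ m := ENNReal.toReal_nonneg
  have hexp : 1 ≤ Real.exp m := Real.one_le_exp hm0
  have hS1 : 1 ≤ 1 + (S z)⁻¹.toReal := le_add_of_nonneg_right ENNReal.toReal_nonneg
  -- `exp m` compensates the normalization of the Poisson density, `1 + 1 / S z` that of Bayes' rule
  refine setKLD_poissonDensity_ne_top hg hDm hD hDfin (a := a * Real.exp m * (1 + (S z)⁻¹.toReal))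
    (b := b) (one_le_mul_of_one_le_of_one_le (one_le_mul_of_one_le_of_one_le ha hexp) hS1) hb ?_
  refine ae_finsetMeasure ?_ fun n => ?_
  · refine measurableSet_le hg.1 (Measurable.mul ?_ (measurable_poissonDensity _ hDm))
    have hcard : Measurable fun X : FiniteSubsets (Trajectory k nx) =>
        Finset.card (α := Trajectory k nx) X := by
      have := measurable_sum_finiteSubsets (T := Trajectory k nx) (h := fun _ => (1 : ℕ))
        measurable_const
      have heq : ∀ X : Finset (Trajectory k nx), X.card = ∑ _x ∈ X, 1 := fun X =>
        Finset.card_eq_sum_ones X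
      exact (funext heq : (fun X : FiniteSubsets (Trajectory k nx) =>
        Finset.card (α := Trajectory k nx) X) = _) ▸ this
    exact ((measurable_of_countable fun n : ℕ =>
      ENNReal.ofReal (a * Real.exp m * (1 + (S z)⁻¹.toReal) * b ^ n)).comp hcard)
  · have hae : ∀ᵐ X ∂(trajMeasure k nx), (∀ w ⊆ z, cellWeight f lam w = 0 →
        detectionWeight f lam X w = 0) ∧ updatedPHD f lamC lam z X =
        (∑ w ∈ z.powerset, detectionWeight f lam X w * S (z \ w)) / S z ∧
        updatedPHD f lamC lam z X ≠ ∞ := by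
      filter_upwards [ae_detectionWeight_eq_zero hf hlam z,
        updatedPHD_ae_eq hf hlam hlam_alive h0 ht, ae_lt_top hDm hDfin] with X h1 h2 h3
      exact ⟨h1, h2, h3.ne⟩
    have hall := ae_all_iff.2 fun i : Fin n => (Measure.tendsto_eval_ae_ae
      (μ := fun _ : Fin n => trajMeasure k nx) (i := i)).eventually hae
    filter_upwards [hall, ae_injective_lastState hnx n] with x hx hinj
    have hinj' : Function.Injective x := fun i j hij => hinj (congrArg Trajectory.lastState hij)
    have hle := hbound n (fun i => detectionWeight f lam (x i))
      (fun i => updatedPHD f lamC lam z (x i)) (fun i => (hx i).1) (fun i w hw => by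
        rw [show updatedPHD f lamC lam z (x i) = _ from (hx i).2.1,
          ENNReal.mul_div_cancel h0 ht]
        exact Finset.single_le_sum (f := fun w => detectionWeight f lam (x i) w * S (z \ w))
          (fun _ _ => zero_le) (Finset.mem_powerset.2 hw)) (fun i => (hx i).2.2)
    have hpois : poissonDensity (trajMeasure k nx) (updatedPHD f lamC lam z) (tupleSet n x) =
        ENNReal.ofReal (Real.exp (-m)) * ∏ i, updatedPHD f lamC lam z (x i) :=
      congrArg (ENNReal.ofReal (Real.exp (-m)) * ·) (prod_tupleSet hinj' _)
    have hcard : Finset.card (α := Trajectory k nx) (tupleSet n x) = n :=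
      (Finset.card_eq_sum_ones (ι := Trajectory k nx) _).trans
        ((sum_tupleSet hinj' fun _ => 1).trans (by simp))
    rw [posterior_tupleSet hnx hf hlam hlam_alive z hinj, hpois, hcard, div_eq_mul_inv]
    have hSinv : (S z)⁻¹ ≤ ENNReal.ofReal (1 + (S z)⁻¹.toReal) := by
      rw [ENNReal.le_ofReal_iff_toReal_le (ENNReal.inv_ne_top.2 h0) (by positivity)]
      linarith
    calc _ ≤ (ENNReal.ofReal (a * b ^ n) * ∏ i, updatedPHD f lamC lam z (x i)) *
          ENNReal.ofReal (1 + (S z)⁻¹.toReal) := mul_le_mul' hle hSinv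
      _ = (ENNReal.ofReal (a * b ^ n) * ENNReal.ofReal (1 + (S z)⁻¹.toReal)) *
          ∏ i, updatedPHD f lamC lam z (x i) := mul_right_comm _ _ _
      _ = _ := by
        rw [← mul_assoc, ← ENNReal.ofReal_mul (by positivity),
          ← ENNReal.ofReal_mul (by positivity)]
        congr 2
        rw [Real.exp_neg]
        field_simp

end Update

/-! ### The best Poisson approximation of the posterior -/

theorem proposition1 (k nx : ℕ) (hnx : 0 < nx)
    {Z : Type*} [MeasureSpace Z] [SigmaFinite (volume : Measure Z)]
    [NullSingletonClass (volume : Measure Z)]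
    (f : TargetState nx → Finset Z → ℝ≥0∞)
    (hf : ∀ x, IsSetDensity volume (f x))
    (hf_meas : ∀ w, Measurable fun x => f x w)
    (lamC : Z → ℝ≥0∞) (hlamC : Measurable lamC) (hlamC_fin : ∫⁻ ζ, lamC ζ ≠ ∞)
    (lam : Trajectory k nx → ℝ≥0∞) (hlam : Measurable lam)
    (hlam_fin : ∫⁻ X, lam X ∂(trajMeasure k nx) ≠ ∞)
    (hlam_alive : ∀ X : Trajectory k nx, ¬ X.IsAlive → lam X = 0)
    (z : Finset Z)
    (hz_pos : evidence f lamC z (poissonDensity (trajMeasure k nx) lam) ≠ 0)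
    (hz_fin : evidence f lamC z (poissonDensity (trajMeasure k nx) lam) ≠ ∞) :
    IsBestPoisson (trajMeasure k nx)
        (posterior f lamC z (poissonDensity (trajMeasure k nx) lam))
        (updatedPHD f lamC lam z) ∧
      (∀ nu : Trajectory k nx → ℝ≥0∞,
        IsBestPoisson (trajMeasure k nx)
          (posterior f lamC z (poissonDensity (trajMeasure k nx) lam)) nu →
        nu =ᵐ[trajMeasure k nx] updatedPHD f lamC lam z) ∧
      phd (trajMeasure k nx) (posterior f lamC z (poissonDensity (trajMeasure k nx) lam))
        =ᵐ[trajMeasure k nx] updatedPHD f lamC lam z := by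
  classical
  have hnull : NullSingletonClass (trajMeasure k nx) := nullSingletonClass_trajMeasure hnx
  have hf_empty : ∀ x, f x ∅ ≤ 1 := fun x => (hf x).apply_empty_le_one
  have hev := evidence_eq (lamC := lamC) hnx hf_meas hlam hlam_alive z
  have h0 : assignSeries (poissonDensity volume lamC) (cellWeight f lam) z ≠ 0 := fun h => by
    rw [h, mul_zero] at hev
    exact hz_pos hev
  have ht : assignSeries (poissonDensity volume lamC) (cellWeight f lam) z ≠ ∞ := fun h => by
    rw [h, ENNReal.mul_top (by simp [Real.exp_pos])] at hev
    exact hz_fin hev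
  have hg := isSetDensity_posterior (lamC := lamC) hf_meas hlam z hz_pos hz_fin
  have hD : phd (trajMeasure k nx) (posterior f lamC z (poissonDensity (trajMeasure k nx) lam))
      =ᵐ[trajMeasure k nx] updatedPHD f lamC lam z := by
    filter_upwards [updatedPHD_ae_eq hf_meas hlam hlam_alive h0 ht] with X hX
    rw [hX, phd_posterior hnx hf_meas hlam hlam_alive]
  have hDm := measurable_updatedPHD (lamC := lamC) hf_meas hlam z
  have hDfin := lintegral_updatedPHD_ne_top hf_meas hf_empty hlam hlam_fin hlam_alive h0 ht
  have hkl := setKLD_posterior_ne_top hnx hf_meas hf_empty hlam hlam_fin hlam_alive z hg hD h0 ht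
  exact ⟨isBestPoisson_phd hg hDm hD hDfin hkl,
    fun nu hnu => hnu.ae_eq_phd hg hDm hD hDfin hkl, hD⟩
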